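/- Let $\mathbb{F}$ be a field, $p\in\mathbb{F}$ with $p\ne 0$, and let $V$ be an $\mathbb{F}$-vector space (of any dimension) with a linearly ordered basis $\mathbb{B}$. For $a,b\in\mathbb{B}$ put $\theta_{a,b}=1$ if $a>b$ and $\theta_{a,b}=0$ otherwise, and let $\tau\colon V\otimes V\to V\otimes V$ be the braiding $$\tau(a\otimes b)=(p^{\theta_{a,b}}-1)\,a\otimes b-p^{\theta_{b,a}}\,b\otimes a\qquad(a,b\in\mathbb{B}).$$ Let $\Lambda_p(V)$ be the exterior algebra $\bigwedge V$, with product $\nabla$ and its usual grading, equipped with - the braiding $\hat\tau$ induced by $\tau$, i.e. the unique linear map $\hat\tau\colon\Lambda_p(V)^{\otimes2}\to\Lambda_p(V)^{\otimes 2}$ with $\hat\tau|_{V\otimes V}=\tau$, $\hat\tau(1\otimes x)=x\otimes1$, $\hat\tau(x\otimes1)=1\otimes x$, and $\hat\tau(\nabla\otimes\nabla)=(\nabla\otimes\nabla)(\mathrm{id}\otimes\hat\tau\otimes\mathrm{id})(\hat\tau\otimes\hat\tau)(\mathrm{id}\otimes\hat\tau\otimes\mathrm{id})$; - the coproduct $\Delta$,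 i.e. the unique linear map with $\Delta(1)=1\otimes1$, $\Delta(v)=v\otimes1+1\otimes v$ for $v\in V$, and $\Delta\nabla=(\nabla\otimes\nabla)(\mathrm{id}\otimes\hat\tau\otimes\mathrm{id})(\Delta\otimes\Delta)$. Let $\pi_k$ be the projection of $\Lambda_p(V)$ onto its degree $k$ part. For $k\ge 0$ define the endomorphisms of $\Lambda_p(V)^{\otimes 2}$ $$L_{(k)}=(\nabla\otimes\mathrm{id})\bigl(\mathrm{id}\otimes(\pi_k\otimes\mathrm{id})\Delta\bigr),\qquad R_{(k)}=(\mathrm{id}\otimes\nabla)\bigl((\mathrm{id}\otimes\pi_k)\Delta\otimes\mathrm{id}\bigr),$$ and set $L=L_{(1)}$, $R=R_{(1)}$. For a finite subset $E\subseteq\mathbb{B}$, let $f_E\in\Lambda_p(V)$ be the product of the elements of $E$ in increasing order, and write $f_{E,F}=f_E\otimes f_F$. Let $[n]_p=\sum_{i=0}^{n-1}p^i$, $[n]_p^!=\prod_{i=1}^n[i]_p$, and $x^{\langle n\rangle_p}=x^n/[n]_p^!$ whenever $[n]_p^!\neq0$. Then: 1. For all finite subsets $E,F\subseteq\mathbb{B}$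 such that $[\max(|E|,|F|)]_p^!\ne0$ (so that all the divided powers below are defined), $$\hat\tau f_{E,F}=\sum_{k=0}^{\min(|E|,|F|)}(-1)^kp^{k(k-1)/2}\,L^{\langle|F|-k\rangle_p}R^{\langle|E|-k\rangle_p}f_{E,F}.$$ 2. For all $m,n\ge0$ (and every $p\ne0$), $$\hat\tau(\pi_m\otimes\pi_n)=\sum_{k=0}^{\min(m,n)}(-1)^kp^{k(k-1)/2}\,L_{(n-k)}R_{(m-k)}(\pi_m\otimes\pi_n).$$ -/

import Mathlib

set_option linter.unusedSimpArgs false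
set_option linter.unusedSectionVars false

open scoped TensorProduct

namespace DeformedExterior

noncomputable section

/-- The Heaviside symbol: `1` if `i > j`, and `0` otherwise. -/
def theta {ι : Type*} [LinearOrder ι] (i j : ι) : ℕ := if j < i then 1 else 0

variable {F V ι : Type*} [Field F] [AddCommGroup V] [Module F V] [LinearOrder ι]
variable (b : Module.Basis ι F V) (p : F)

/-- The Hecke type braiding of `V`: on basis vectors,
`a ⊗ c ↦ (p ^ θ(a, c) - 1) a ⊗ c - p ^ θ(c, a) c ⊗ a`. -/
def vecBraiding : V ⊗[F] V →ₗ[F] V ⊗[F] V :=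
  TensorProduct.lift (b.constr F fun i => b.constr F fun j =>
    (p ^ theta i j - 1) • (b i ⊗ₜ[F] b j) - p ^ theta j i • (b j ⊗ₜ[F] b i))

theorem vecBraiding_basis (i j : ι) : vecBraiding b p (b i ⊗ₜ b j) =
    (p ^ theta i j - 1) • (b i ⊗ₜ[F] b j) - p ^ theta j i • (b j ⊗ₜ[F] b i) := by
  simp [vecBraiding]

theorem theta_cases_A {M : Type*} [AddCommGroup M] [Module F M] (K : ι → ι → ι → M)
    (h0 : ∀ x a, K x a a = 0) (h1 : ∀ x a c, K x c a = - K x a c) (i j k : ι)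
    (T : (ι → ι → M) → ι → ι → M)
    (hT : ∀ f i j, T f i j = (p ^ theta i j - 1) • f i j - p ^ theta j i • f j i) :
    T (fun y v => T (fun x w => K x w v) i y) j k
      + T (fun y v => T (fun x w => K x w v) j y) i k = 0 := by
  have h2 : ∀ x a c, a < c → K x c a = - K x a c := fun x a c _ => h1 x a c
  clear h1
  simp only [hT]
  rcases lt_trichotomy i j with h | h | h <;> rcases lt_trichotomy i k with h' | h' | h' <;>
  rcases lt_trichotomy j k with h'' | h'' | h'' <;>
  first
  | (exfalso; order)
  | (subst_vars
     simp only [theta, h, h', h'', if_true, lt_irrefl, if_false, not_lt_of_gt h, not_lt_of_gt h',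
       not_lt_of_gt h'', pow_one, pow_zero, h2 _ _ _ h, h2 _ _ _ h', h2 _ _ _ h'', h0]
     module)
  | (subst_vars
     simp only [theta, *, if_true, lt_irrefl, if_false, pow_one, pow_zero, h2 _ _ _ h, h0, not_lt_of_gt h]
     module)
  | (subst_vars
     simp only [theta, *, if_true, lt_irrefl, if_false, pow_one, pow_zero, h2 _ _ _ h', h0, not_lt_of_gt h']
     module)
  | (subst_vars
     simp only [theta, lt_irrefl, if_false, pow_zero, h0]
     module)

theorem theta_cases_B {M : Type*} [AddCommGroup M] [Module F M] (K : ι → ι → ι → M)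
    (h0 : ∀ x a, K a a x = 0) (h1 : ∀ x a c, K c a x = - K a c x) (i j k : ι)
    (T : (ι → ι → M) → ι → ι → M)
    (hT : ∀ f i j, T f i j = (p ^ theta i j - 1) • f i j - p ^ theta j i • f j i) :
    T (fun x v => T (fun y w => K x y w) v j) k i
      + T (fun x v => T (fun y w => K x y w) v i) k j = 0 := by
  have h2 : ∀ x a c, a < c → K c a x = - K a c x := fun x a c _ => h1 x a c
  clear h1
  simp only [hT]
  rcases lt_trichotomy i j with h | h | h <;> rcases lt_trichotomy i k with h' | h' | h' <;>
  rcases lt_trichotomy j k with h'' | h'' | h'' <;>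
  first
  | (exfalso; order)
  | (subst_vars
     simp only [theta, h, h', h'', if_true, lt_irrefl, if_false, not_lt_of_gt h, not_lt_of_gt h',
       not_lt_of_gt h'', pow_one, pow_zero, h2 _ _ _ h, h2 _ _ _ h', h2 _ _ _ h'', h0]
     module)
  | (subst_vars
     simp only [theta, *, if_true, lt_irrefl, if_false, pow_one, pow_zero, h2 _ _ _ h, h0, not_lt_of_gt h]
     module)
  | (subst_vars
     simp only [theta, *, if_true, lt_irrefl, if_false, pow_one, pow_zero, h2 _ _ _ h', h0, not_lt_of_gt h']
     module)
  | (subst_vars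
     simp only [theta, lt_irrefl, if_false, pow_zero, h0]
     module)

theorem alternating_of_basis {M : Type*} [AddCommGroup M] [Module F M] (B : V →ₗ[F] V →ₗ[F] M)
    (h : ∀ i j, B (b i) (b j) + B (b j) (b i) = 0) (h0 : ∀ i, B (b i) (b i) = 0) (v : V) :
    B v v = 0 := by
  have h1 : B + B.flip = 0 := b.ext fun i => b.ext fun j => by simpa using h i j
  have hv : v ∈ Submodule.span F (Set.range b) := b.mem_span v
  induction hv using Submodule.span_induction with
  | zero => simp
  | add x y _ _ hx hy =>
    have h2 : B x y + B y x = 0 := by simpa using congrArg (fun C => C x y) h1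
    simp only [map_add, LinearMap.add_apply, hx, hy, zero_add, add_zero]
    rw [add_comm, h2]
  | smul c x _ hx => simp [hx]
  | mem x hx =>
    obtain ⟨i, rfl⟩ := hx
    exact h0 i

local notation "𝐀" => ExteriorAlgebra F V

/-- `crossStep b p v : s ⊗ u ↦ ∑ s xᵢ ⊗ uᵢ`, where `τ (u ⊗ v) = ∑ xᵢ ⊗ uᵢ`: the vector `v` crosses
the strand carrying `u` by `τ` and is multiplied into the exterior algebra strand on the left. -/
def crossStep : V →ₗ[F] 𝐀 ⊗[F] V →ₗ[F] 𝐀 ⊗[F] V :=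
  LinearMap.flip (TensorProduct.lift (LinearMap.compl₂
    (LinearMap.llcomp F V (V ⊗[F] V) (𝐀 ⊗[F] V) ∘ₗ
      (LinearMap.rTensorHom V ∘ₗ (LinearMap.mul F 𝐀).compl₂ (ExteriorAlgebra.ι F)))
    (TensorProduct.curry (vecBraiding b p))))

theorem crossStep_tmul (v u : V) (s : 𝐀) : crossStep b p v (s ⊗ₜ u) =
    LinearMap.rTensor V (LinearMap.mulLeft F s ∘ₗ ExteriorAlgebra.ι F)
      (vecBraiding b p (u ⊗ₜ v)) := rfl

theorem crossStep_basis (i k : ι) (s : 𝐀) : crossStep b p (b i) (s ⊗ₜ b k) =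
    (p ^ theta k i - 1) • ((s * ExteriorAlgebra.ι F (b k)) ⊗ₜ[F] b i)
      - p ^ theta i k • ((s * ExteriorAlgebra.ι F (b i)) ⊗ₜ[F] b k) := by
  simp [crossStep_tmul, vecBraiding_basis]

theorem ι_mul_ι_self (s : 𝐀) (v : V) :
    s * ExteriorAlgebra.ι F v * ExteriorAlgebra.ι F v = 0 := by
  rw [mul_assoc, ExteriorAlgebra.ι_sq_zero, mul_zero]

theorem ι_mul_ι_swap (s : 𝐀) (v w : V) :
    s * ExteriorAlgebra.ι F v * ExteriorAlgebra.ι F w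
      = - (s * ExteriorAlgebra.ι F w * ExteriorAlgebra.ι F v) := by
  rw [mul_assoc, mul_assoc, ← mul_neg, eq_neg_of_add_eq_zero_left (ExteriorAlgebra.ι_add_mul_swap v w)]

theorem crossStep_anticomm (i j : ι) :
    crossStep b p (b i) ∘ₗ crossStep b p (b j) + crossStep b p (b j) ∘ₗ crossStep b p (b i) = 0 := by
  refine TensorProduct.ext (LinearMap.ext fun s => b.ext fun k => ?_)
  have := theta_cases_B p (fun x y u => (s * ExteriorAlgebra.ι F (b x) * ExteriorAlgebra.ι F (b y))
      ⊗ₜ[F] b u) (fun x a => by simp [ι_mul_ι_self])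
      (fun x a c => by rw [ι_mul_ι_swap, TensorProduct.neg_tmul]) j i k _ (fun f i j => rfl)
  simpa [crossStep_basis] using this

theorem crossStep_sq_basis (i : ι) : crossStep b p (b i) ∘ₗ crossStep b p (b i) = 0 := by
  refine TensorProduct.ext (LinearMap.ext fun s => b.ext fun k => ?_)
  rcases eq_or_ne k i with rfl | h
  · simp [crossStep_basis, ι_mul_ι_self, theta]
  · rcases lt_or_gt_of_ne h with h | h
    · simp [crossStep_basis, ι_mul_ι_self, theta, h, not_lt_of_gt h]
    · simp [crossStep_basis, ι_mul_ι_self, theta, h, not_lt_of_gt h, ι_mul_ι_swap s (b k) (b i)]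
      simp [TensorProduct.neg_tmul]

theorem sq_eq_zero_of_basis {M : Type*} [AddCommGroup M] [Module F M] (B : V →ₗ[F] Module.End F M)
    (h : ∀ i j, B (b i) * B (b j) + B (b j) * B (b i) = 0) (h0 : ∀ i, B (b i) * B (b i) = 0)
    (v : V) : B v * B v = 0 := by
  have := alternating_of_basis b ((LinearMap.mul F (Module.End F M)).compl₁₂ B B)
    (fun i j => by simpa using h i j) (fun i => by simpa using h0 i) v
  simpa using this

theorem crossStep_sq (v : V) : crossStep b p v * crossStep b p v = 0 :=
  sq_eq_zero_of_basis b (crossStep b p) (crossStep_anticomm b p) (crossStep_sq_basis b p) v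

/-- The extension of `crossStep` to the exterior algebra (an anti-homomorphism): the operators
through which elements of `⋀ V` cross a strand carrying a vector. -/
def crossHom : 𝐀 →ₐ[F] (Module.End F (𝐀 ⊗[F] V))ᵐᵒᵖ :=
  ExteriorAlgebra.lift F ⟨(MulOpposite.opLinearEquiv F).toLinearMap ∘ₗ crossStep b p, fun v => by
    have := crossStep_sq b p v
    simp only [LinearMap.comp_apply, LinearEquiv.coe_coe, MulOpposite.coe_opLinearEquiv]
    rw [← MulOpposite.op_mul, this, MulOpposite.op_zero]⟩

theorem crossHom_ι (v : V) :
    crossHom b p (ExteriorAlgebra.ι F v) = MulOpposite.op (crossStep b p v) := by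
  simp [crossHom]

theorem crossHom_mulLeft (s y : 𝐀) (z : 𝐀 ⊗[F] V) :
    (crossHom b p s).unop (LinearMap.rTensor V (LinearMap.mulLeft F y) z)
      = LinearMap.rTensor V (LinearMap.mulLeft F y) ((crossHom b p s).unop z) := by
  induction s using ExteriorAlgebra.induction generalizing z with
  | algebraMap r => simp [AlgHom.commutes, MulOpposite.algebraMap_apply, Algebra.algebraMap_eq_smul_one]
  | ι x =>
    rw [crossHom_ι, MulOpposite.unop_op]
    induction z with
    | zero => simp
    | add z w hz hw => simp only [map_add, hz, hw]
    | tmul s u =>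
      simp only [LinearMap.rTensor_tmul, LinearMap.mulLeft_apply, crossStep_tmul]
      rw [← LinearMap.rTensor_comp_apply]
      congr 2
      ext; simp [mul_assoc]
  | mul s t hs ht => simp only [map_mul, MulOpposite.unop_mul, Module.End.mul_apply, hs, ht]
  | add s t hs ht => simp only [map_add, MulOpposite.unop_add, LinearMap.add_apply, hs, ht]

/-- The braiding of `V` with `⋀ V`: the map `v ⊗ s ↦ τ̂ (v ⊗ s) ∈ ⋀ V ⊗ V`, in curried form. -/
def vecCross : V →ₗ[F] 𝐀 →ₗ[F] 𝐀 ⊗[F] V :=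
  LinearMap.lcomp F (𝐀 ⊗[F] V)
      ((MulOpposite.opLinearEquiv F).symm.toLinearMap ∘ₗ (crossHom b p).toLinearMap)
    ∘ₗ LinearMap.applyₗ ∘ₗ TensorProduct.mk F 𝐀 V 1

theorem vecCross_apply (v : V) (s : 𝐀) :
    vecCross b p v s = (crossHom b p s).unop (1 ⊗ₜ v) := rfl

theorem vecCross_one (v : V) : vecCross b p v 1 = 1 ⊗ₜ v := by
  simp [vecCross_apply]

theorem crossHom_unop (s y : 𝐀) (u : V) : (crossHom b p s).unop (y ⊗ₜ u) =
    LinearMap.rTensor V (LinearMap.mulLeft F y) (vecCross b p u s) := by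
  rw [vecCross_apply, ← crossHom_mulLeft]; simp

theorem vecCross_mul (v : V) (s t : 𝐀) :
    vecCross b p v (s * t) = (crossHom b p t).unop (vecCross b p v s) := by
  simp [vecCross_apply]

theorem vecCross_basis (i k : ι) (s : 𝐀) :
    vecCross b p (b i) (ExteriorAlgebra.ι F (b k) * s) =
      (p ^ theta i k - 1) • LinearMap.rTensor V (LinearMap.mulLeft F (ExteriorAlgebra.ι F (b i)))
          (vecCross b p (b k) s)
        - p ^ theta k i • LinearMap.rTensor V (LinearMap.mulLeft F (ExteriorAlgebra.ι F (b k)))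
          (vecCross b p (b i) s) := by
  rw [vecCross_mul, vecCross_apply, crossHom_ι, MulOpposite.unop_op, crossStep_basis]
  simp [crossHom_unop]

/-- `(x ⊗ w) ⊗ t ↦ x ⊗ (w ∧ t)`, in curried form. -/
def absorb : 𝐀 ⊗[F] V →ₗ[F] 𝐀 →ₗ[F] 𝐀 ⊗[F] 𝐀 :=
  TensorProduct.lift (LinearMap.compl₂ (LinearMap.llcomp F 𝐀 𝐀 (𝐀 ⊗[F] 𝐀) ∘ₗ TensorProduct.mk F 𝐀 𝐀)
    (LinearMap.mul F 𝐀 ∘ₗ ExteriorAlgebra.ι F))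

theorem absorb_tmul (x t : 𝐀) (w : V) :
    absorb (x ⊗ₜ w) t = x ⊗ₜ[F] (ExteriorAlgebra.ι F w * t) := rfl

/-- `braidStep b p v : s ⊗ t ↦ (id ⊗ ∇) (τ̂ (v ⊗ s) ⊗ t)`. -/
def braidStep : V →ₗ[F] Module.End F (𝐀 ⊗[F] 𝐀) :=
  TensorProduct.uncurry (.id F) 𝐀 𝐀 (𝐀 ⊗[F] 𝐀) ∘ₗ (vecCross b p).compr₂ absorb

theorem braidStep_tmul (v : V) (s t : 𝐀) :
    braidStep b p v (s ⊗ₜ t) = absorb (vecCross b p v s) t := rfl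

theorem braidStep_one_tmul (v : V) (t : 𝐀) :
    braidStep b p v (1 ⊗ₜ t) = 1 ⊗ₜ (ExteriorAlgebra.ι F v * t) := by
  rw [braidStep_tmul, vecCross_one, absorb_tmul]

/-- Left multiplication by a vector on the left tensor factor. -/
def leftMul : V →ₗ[F] Module.End F (𝐀 ⊗[F] 𝐀) :=
  LinearMap.rTensorHom 𝐀 ∘ₗ LinearMap.mul F 𝐀 ∘ₗ ExteriorAlgebra.ι F

theorem leftMul_tmul (v : V) (s t : 𝐀) :
    leftMul v (s ⊗ₜ t) = (ExteriorAlgebra.ι F v * s) ⊗ₜ[F] t := rfl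

theorem absorb_mulLeft (y t : 𝐀) (z : 𝐀 ⊗[F] V) :
    absorb (LinearMap.rTensor V (LinearMap.mulLeft F y) z) t
      = LinearMap.rTensor 𝐀 (LinearMap.mulLeft F y) (absorb z t) := by
  induction z with
  | zero => simp
  | add z w hz hw => simp only [map_add, LinearMap.add_apply, hz, hw]
  | tmul s u => simp [absorb_tmul]

theorem braidStep_leftMul (i k : ι) :
    braidStep b p (b i) * leftMul (b k) =
      (p ^ theta i k - 1) • (leftMul (b i) * braidStep b p (b k))
        - p ^ theta k i • (leftMul (b k) * braidStep b p (b i)) := by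
  refine TensorProduct.ext' fun s t => ?_
  simp only [Module.End.mul_apply, leftMul_tmul, braidStep_tmul, vecCross_basis, map_sub, map_smul,
    LinearMap.sub_apply, LinearMap.smul_apply, absorb_mulLeft]
  rfl

theorem braidStep_leftMul_apply (i k : ι) (z : 𝐀 ⊗[F] 𝐀) :
    braidStep b p (b i) (leftMul (b k) z) =
      (p ^ theta i k - 1) • (leftMul (b i) (braidStep b p (b k) z))
        - p ^ theta k i • (leftMul (b k) (braidStep b p (b i) z)) :=
  congrArg (fun f : Module.End F (𝐀 ⊗[F] 𝐀) => f z) (braidStep_leftMul b p i k)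

theorem braidStep_anticomm_tmul (s : 𝐀) :
    ∀ (t : 𝐀) (i j : ι), braidStep b p (b i) (braidStep b p (b j) (s ⊗ₜ t))
        + braidStep b p (b j) (braidStep b p (b i) (s ⊗ₜ t)) = 0
      ∧ braidStep b p (b i) (braidStep b p (b i) (s ⊗ₜ t)) = 0 := by
  induction s using CliffordAlgebra.left_induction with
  | algebraMap r =>
    intro t i j
    rw [Algebra.algebraMap_eq_smul_one, TensorProduct.smul_tmul]
    simp only [braidStep_one_tmul, ← TensorProduct.tmul_add, ← mul_assoc, ← add_mul,
      ExteriorAlgebra.ι_add_mul_swap, ExteriorAlgebra.ι_sq_zero, zero_mul, TensorProduct.tmul_zero,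
      and_self]
  | add x y hx hy =>
    intro t i j
    simp only [TensorProduct.add_tmul, map_add]
    refine ⟨?_, by rw [(hx t i j).2, (hy t i j).2, add_zero]⟩
    rw [add_add_add_comm, (hx t i j).1, (hy t i j).1, add_zero]
  | ι_mul x m hx =>
    intro t i j
    have hm : m ∈ Submodule.span F (Set.range b) := b.mem_span m
    change _ ∧ braidStep b p (b i) (braidStep b p (b i)
      ((ExteriorAlgebra.ι F m * x) ⊗ₜ[F] t)) = 0
    change braidStep b p (b i) (braidStep b p (b j) ((ExteriorAlgebra.ι F m * x) ⊗ₜ[F] t))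
        + braidStep b p (b j) (braidStep b p (b i) ((ExteriorAlgebra.ι F m * x) ⊗ₜ[F] t)) = 0 ∧ _
    rw [← leftMul_tmul]
    induction hm using Submodule.span_induction with
    | zero => simp
    | add y z _ _ hy hz =>
      simp only [map_add, LinearMap.add_apply]
      refine ⟨?_, by rw [hy.2, hz.2, add_zero]⟩
      rw [add_add_add_comm, hy.1, hz.1, add_zero]
    | smul c y _ hy =>
      simp only [map_smul, LinearMap.smul_apply, ← smul_add, hy.1, hy.2, smul_zero, and_self]
    | mem y hy =>
      obtain ⟨k, rfl⟩ := hy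
      have key : ∀ i j, braidStep b p (b i) (braidStep b p (b j) (leftMul (b k) (x ⊗ₜ[F] t)))
          + braidStep b p (b j) (braidStep b p (b i) (leftMul (b k) (x ⊗ₜ[F] t))) = 0 := by
        intro i j
        have := theta_cases_A p (fun y u w => leftMul (b y) (braidStep b p (b u)
          (braidStep b p (b w) (x ⊗ₜ[F] t)))) (fun y a => by simp [(hx t a a).2])
          (fun y a c => by
            rw [← map_neg, eq_neg_of_add_eq_zero_left (hx t c a).1]) i j k _ (fun f i j => rfl)
        simp only [braidStep_leftMul_apply, map_sub, map_smul]
        simpa using this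
      refine ⟨key i j, ?_⟩
      simp only [braidStep_leftMul_apply, map_sub, map_smul, (hx t i i).2, (hx t k k).2]
      have h1 := eq_neg_of_add_eq_zero_left (hx t i k).1
      rcases lt_trichotomy i k with h | rfl | h
      · simp [theta, h, not_lt_of_gt h]
      · simp [theta, (hx t i i).2]
      · simp [theta, h, not_lt_of_gt h, h1]
        try module

theorem braidStep_anticomm (i j : ι) :
    braidStep b p (b i) * braidStep b p (b j) + braidStep b p (b j) * braidStep b p (b i) = 0 :=
  TensorProduct.ext' fun s t => (braidStep_anticomm_tmul b p s t i j).1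

theorem braidStep_sq_basis (i : ι) : braidStep b p (b i) * braidStep b p (b i) = 0 :=
  TensorProduct.ext' fun s t => (braidStep_anticomm_tmul b p s t i i).2

theorem braidStep_sq (v : V) : braidStep b p v * braidStep b p v = 0 :=
  sq_eq_zero_of_basis b (braidStep b p) (braidStep_anticomm b p) (braidStep_sq_basis b p) v

/-- The operators `t ↦ (s ⊗ r ↦ (id ⊗ ∇) (τ̂ (t ⊗ s) ⊗ r))`. -/
def braidHom : 𝐀 →ₐ[F] Module.End F (𝐀 ⊗[F] 𝐀) :=
  ExteriorAlgebra.lift F ⟨braidStep b p, braidStep_sq b p⟩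

theorem braidHom_ι (v : V) : braidHom b p (ExteriorAlgebra.ι F v) = braidStep b p v := by
  simp [braidHom]

/-- The braiding `τ̂` of the exterior algebra that is induced by `vecBraiding b p`. -/
def braiding : 𝐀 ⊗[F] 𝐀 →ₗ[F] 𝐀 ⊗[F] 𝐀 :=
  TensorProduct.lift
    ((braidHom b p).toLinearMap.compl₂ ((TensorProduct.mk F 𝐀 𝐀).flip 1))

theorem braiding_tmul (t s : 𝐀) : braiding b p (t ⊗ₜ s) = braidHom b p t (s ⊗ₜ 1) := rfl

/-- Left multiplication by `v ⊗ 1 + 1 ⊗ v` on the braided tensor square of the exterior algebra. -/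
def comulStep : V →ₗ[F] Module.End F (𝐀 ⊗[F] 𝐀) := leftMul + braidStep b p

theorem leftMul_anticomm (v w : V) :
    leftMul v * leftMul w + leftMul w * leftMul v = (0 : Module.End F (𝐀 ⊗[F] 𝐀)) :=
  TensorProduct.ext' fun s t => by
    simp only [LinearMap.add_apply, Module.End.mul_apply, leftMul_tmul, ← TensorProduct.add_tmul,
      ← mul_assoc, ← add_mul, ExteriorAlgebra.ι_add_mul_swap, zero_mul, TensorProduct.zero_tmul,
      LinearMap.zero_apply]

theorem leftMul_sq (v : V) : leftMul v * leftMul v = (0 : Module.End F (𝐀 ⊗[F] 𝐀)) :=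
  TensorProduct.ext' fun s t => by
    simp only [Module.End.mul_apply, leftMul_tmul, ← mul_assoc, ExteriorAlgebra.ι_sq_zero, zero_mul,
      TensorProduct.zero_tmul, LinearMap.zero_apply]

theorem comulStep_sq (v : V) : comulStep b p v * comulStep b p v = 0 := by
  refine sq_eq_zero_of_basis b (comulStep b p) (fun i j => ?_) (fun i => ?_) v
  · have h1 := leftMul_anticomm (F := F) (b i) (b j)
    have h2 := braidStep_anticomm b p i j
    simp only [comulStep, LinearMap.add_apply, add_mul, mul_add, braidStep_leftMul]
    rw [← add_zero (0 : Module.End F (𝐀 ⊗[F] 𝐀))]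
    nth_rewrite 1 [← h1]
    rw [← h2]
    module
  · simp only [comulStep, LinearMap.add_apply, add_mul, mul_add, braidStep_leftMul, leftMul_sq,
      braidStep_sq_basis]
    simp [theta]

/-- The coproduct as left multiplication operators on the braided tensor square. -/
def comulHom : 𝐀 →ₐ[F] Module.End F (𝐀 ⊗[F] 𝐀) :=
  ExteriorAlgebra.lift F ⟨comulStep b p, comulStep_sq b p⟩

theorem comulHom_ι (v : V) : comulHom b p (ExteriorAlgebra.ι F v) = comulStep b p v := by
  simp [comulHom]

/-- The coproduct of the exterior algebra for which all vectors are primitive. -/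
def comul : 𝐀 →ₗ[F] 𝐀 ⊗[F] 𝐀 := LinearMap.applyₗ (1 ⊗ₜ[F] 1) ∘ₗ (comulHom b p).toLinearMap

theorem comul_apply (t : 𝐀) : comul b p t = comulHom b p t (1 ⊗ₜ 1) := rfl

/-- `id ⊗ c ⊗ id` on the fourfold tensor power, grouped as two pairs. -/
def middle (c : 𝐀 ⊗[F] 𝐀 →ₗ[F] 𝐀 ⊗[F] 𝐀) :
    (𝐀 ⊗[F] 𝐀) ⊗[F] (𝐀 ⊗[F] 𝐀) →ₗ[F] (𝐀 ⊗[F] 𝐀) ⊗[F] (𝐀 ⊗[F] 𝐀) :=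
  (TensorProduct.assoc F 𝐀 𝐀 (𝐀 ⊗[F] 𝐀)).symm.toLinearMap
    ∘ₗ LinearMap.lTensor 𝐀 ((TensorProduct.assoc F 𝐀 𝐀 𝐀).toLinearMap
      ∘ₗ LinearMap.rTensor 𝐀 c ∘ₗ (TensorProduct.assoc F 𝐀 𝐀 𝐀).symm.toLinearMap)
    ∘ₗ (TensorProduct.assoc F 𝐀 𝐀 (𝐀 ⊗[F] 𝐀)).toLinearMap

/-- `∇ ⊗ ∇`. -/
def mulMul : (𝐀 ⊗[F] 𝐀) ⊗[F] (𝐀 ⊗[F] 𝐀) →ₗ[F] 𝐀 ⊗[F] 𝐀 :=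
  TensorProduct.map (LinearMap.mul' F 𝐀) (LinearMap.mul' F 𝐀)

/-- The braiding `c` of the exterior algebra is induced by the braiding `vecBraiding b p` of `V`:
it restricts to it on vectors, and is compatible with the unit and the product. -/
structure IsInducedBraiding (c : 𝐀 ⊗[F] 𝐀 →ₗ[F] 𝐀 ⊗[F] 𝐀) : Prop where
  restrict : c ∘ₗ TensorProduct.map (ExteriorAlgebra.ι F) (ExteriorAlgebra.ι F)
    = TensorProduct.map (ExteriorAlgebra.ι F) (ExteriorAlgebra.ι F) ∘ₗ vecBraiding b p
  one_tmul : ∀ x, c (1 ⊗ₜ x) = x ⊗ₜ 1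
  tmul_one : ∀ x, c (x ⊗ₜ 1) = 1 ⊗ₜ x
  fusion : c ∘ₗ mulMul = mulMul ∘ₗ middle c ∘ₗ TensorProduct.map c c ∘ₗ middle c

/-- `Δ` is multiplicative for the braiding `c`, and all vectors are primitive. -/
structure IsBraidedCoproduct (c : 𝐀 ⊗[F] 𝐀 →ₗ[F] 𝐀 ⊗[F] 𝐀) (Δ : 𝐀 →ₗ[F] 𝐀 ⊗[F] 𝐀) : Prop where
  one : Δ 1 = 1 ⊗ₜ 1
  primitive : ∀ v : V, Δ (ExteriorAlgebra.ι F v)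
    = ExteriorAlgebra.ι F v ⊗ₜ 1 + 1 ⊗ₜ ExteriorAlgebra.ι F v
  mul : Δ ∘ₗ LinearMap.mul' F 𝐀 = mulMul ∘ₗ middle c ∘ₗ TensorProduct.map Δ Δ

theorem absorb_mul (z : 𝐀 ⊗[F] V) (t r : 𝐀) :
    absorb z (t * r) = LinearMap.lTensor 𝐀 (LinearMap.mulRight F r) (absorb z t) := by
  induction z with
  | zero => simp
  | add z w hz hw => simp only [map_add, LinearMap.add_apply, hz, hw]
  | tmul s u => simp [absorb_tmul, mul_assoc]

theorem braidHom_mulRight (t r : 𝐀) (z : 𝐀 ⊗[F] 𝐀) :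
    braidHom b p t (LinearMap.lTensor 𝐀 (LinearMap.mulRight F r) z)
      = LinearMap.lTensor 𝐀 (LinearMap.mulRight F r) (braidHom b p t z) := by
  induction t using ExteriorAlgebra.induction generalizing z with
  | algebraMap r => simp [AlgHom.commutes, Algebra.algebraMap_eq_smul_one]
  | ι x =>
    rw [braidHom_ι]
    induction z with
    | zero => simp
    | add z w hz hw => simp only [map_add, hz, hw]
    | tmul s u => simp [braidStep_tmul, absorb_mul]
  | mul s t hs ht => simp only [map_mul, Module.End.mul_apply, hs, ht]
  | add s t hs ht => simp only [map_add, LinearMap.add_apply, hs, ht]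

theorem braidHom_tmul (t s r : 𝐀) : braidHom b p t (s ⊗ₜ r)
    = LinearMap.lTensor 𝐀 (LinearMap.mulRight F r) (braiding b p (t ⊗ₜ s)) := by
  rw [braiding_tmul, ← braidHom_mulRight]; simp

/-- `(y ⊗ u) ↦ (y ⊗ 1) τ̂ (u ⊗ s) (1 ⊗ r)`. -/
def sandwich (s r : 𝐀) : 𝐀 ⊗[F] 𝐀 →ₗ[F] 𝐀 ⊗[F] 𝐀 :=
  TensorProduct.lift (LinearMap.compl₂ (LinearMap.rTensorHom 𝐀 ∘ₗ LinearMap.mul F 𝐀)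
    (LinearMap.applyₗ (s ⊗ₜ[F] r) ∘ₗ (braidHom b p).toLinearMap))

theorem sandwich_tmul (s r y u : 𝐀) : sandwich b p s r (y ⊗ₜ u)
    = LinearMap.rTensor 𝐀 (LinearMap.mulLeft F y) (braidHom b p u (s ⊗ₜ r)) := rfl

/-- `(y ⊗ v) ↦ (y ⊗ 1) braidStep v z`. -/
def sandwichVec (z : 𝐀 ⊗[F] 𝐀) : 𝐀 ⊗[F] V →ₗ[F] 𝐀 ⊗[F] 𝐀 :=
  TensorProduct.lift (LinearMap.compl₂ (LinearMap.rTensorHom 𝐀 ∘ₗ LinearMap.mul F 𝐀)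
    (LinearMap.applyₗ z ∘ₗ braidStep b p))

theorem sandwichVec_tmul (z : 𝐀 ⊗[F] 𝐀) (y : 𝐀) (v : V) : sandwichVec b p z (y ⊗ₜ v)
    = LinearMap.rTensor 𝐀 (LinearMap.mulLeft F y) (braidStep b p v z) := rfl

theorem sandwichVec_add (z w : 𝐀 ⊗[F] 𝐀) :
    sandwichVec b p (z + w) = sandwichVec b p z + sandwichVec b p w :=
  TensorProduct.ext' fun y v => by
    simp only [LinearMap.add_apply, sandwichVec_tmul, map_add]

theorem braidStep_mulLeft (v : V) (y : 𝐀) (z : 𝐀 ⊗[F] 𝐀) :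
    braidStep b p v (LinearMap.rTensor 𝐀 (LinearMap.mulLeft F y) z)
      = sandwichVec b p z (vecCross b p v y) := by
  induction z with
  | zero =>
    have : sandwichVec b p 0 = 0 := TensorProduct.ext' fun y v => by
      simp [sandwichVec_tmul]
    simp [this]
  | add z w hz hw => rw [map_add, map_add, hz, hw, sandwichVec_add, LinearMap.add_apply]
  | tmul s t =>
    rw [LinearMap.rTensor_tmul, LinearMap.mulLeft_apply, braidStep_tmul, vecCross_mul]
    generalize vecCross b p v y = Z
    induction Z with
    | zero => simp
    | add z w hz hw => simp only [map_add, LinearMap.add_apply, hz, hw]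
    | tmul y u => rw [crossHom_unop, absorb_mulLeft, sandwichVec_tmul, braidStep_tmul]

theorem braidStep_sandwich (s r : 𝐀) (v : V) (z : 𝐀 ⊗[F] 𝐀) :
    braidStep b p v (sandwich b p s r z) = sandwich b p s r (braidStep b p v z) := by
  induction z with
  | zero => simp
  | add z w hz hw => simp only [map_add, hz, hw]
  | tmul y u =>
    rw [sandwich_tmul, braidStep_mulLeft, braidStep_tmul]
    generalize vecCross b p v y = Z
    induction Z with
    | zero => simp
    | add z w hz hw => simp only [map_add, LinearMap.add_apply, hz, hw]
    | tmul y w =>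
      rw [sandwichVec_tmul, absorb_tmul, sandwich_tmul, map_mul, braidHom_ι, Module.End.mul_apply]

theorem leftMul_sandwich (s r : 𝐀) (v : V) (z : 𝐀 ⊗[F] 𝐀) :
    leftMul v (sandwich b p s r z) = sandwich b p s r (leftMul v z) := by
  induction z with
  | zero => simp
  | add z w hz hw => simp only [map_add, hz, hw]
  | tmul y u =>
    rw [sandwich_tmul, leftMul_tmul, sandwich_tmul]
    generalize braidHom b p u (s ⊗ₜ r) = Z
    induction Z with
    | zero => simp
    | add z w hz hw => simp only [map_add, hz, hw]
    | tmul x w => simp [leftMul_tmul, mul_assoc]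

theorem braidHom_mul_tmul (t s s' r : 𝐀) :
    braidHom b p t ((s * s') ⊗ₜ r) = sandwich b p s' r (braiding b p (t ⊗ₜ s)) := by
  rw [braiding_tmul]
  induction t using CliffordAlgebra.left_induction with
  | algebraMap c =>
    rw [AlgHom.commutes, Module.algebraMap_end_apply, Module.algebraMap_end_apply, map_smul,
      sandwich_tmul]
    simp
  | add x y hx hy => simp only [map_add, LinearMap.add_apply, hx, hy]
  | ι_mul x v hx =>
    change braidHom b p (ExteriorAlgebra.ι F v * x) _
      = sandwich b p s' r (braidHom b p (ExteriorAlgebra.ι F v * x) _)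
    rw [map_mul, Module.End.mul_apply, Module.End.mul_apply, hx, braidHom_ι, braidStep_sandwich]

theorem middle_tmul (c : 𝐀 ⊗[F] 𝐀 →ₗ[F] 𝐀 ⊗[F] 𝐀) (x y z w : 𝐀) :
    middle c ((x ⊗ₜ y) ⊗ₜ (z ⊗ₜ w)) = (TensorProduct.assoc F 𝐀 𝐀 (𝐀 ⊗[F] 𝐀)).symm
      (x ⊗ₜ TensorProduct.assoc F 𝐀 𝐀 𝐀 (c (y ⊗ₜ z) ⊗ₜ w)) := rfl

theorem mulMul_middle (s t : 𝐀) (z : 𝐀 ⊗[F] 𝐀) :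
    mulMul (middle (braiding b p) (z ⊗ₜ (s ⊗ₜ t))) = sandwich b p s t z := by
  induction z with
  | zero => simp
  | add z w hz hw => simp only [TensorProduct.add_tmul, map_add, hz, hw]
  | tmul y u =>
    rw [middle_tmul, sandwich_tmul, braidHom_tmul]
    generalize braiding b p (u ⊗ₜ s) = Z
    induction Z with
    | zero => simp
    | add z w hz hw => simp only [TensorProduct.add_tmul, TensorProduct.tmul_add, map_add, hz, hw]
    | tmul x w => simp [mulMul]

theorem braiding_tmul_one (x : 𝐀) : braiding b p (x ⊗ₜ 1) = 1 ⊗ₜ x := by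
  rw [braiding_tmul]
  induction x using CliffordAlgebra.left_induction with
  | algebraMap c =>
    rw [AlgHom.commutes, Module.algebraMap_end_apply, Algebra.algebraMap_eq_smul_one,
      TensorProduct.tmul_smul]
  | add x y hx hy => simp only [map_add, LinearMap.add_apply, hx, hy, TensorProduct.tmul_add]
  | ι_mul x v hx =>
    change braidHom b p (ExteriorAlgebra.ι F v * x) _ = 1 ⊗ₜ (ExteriorAlgebra.ι F v * x)
    rw [map_mul, Module.End.mul_apply, hx, braidHom_ι, braidStep_one_tmul]

theorem braiding_fusion : braiding b p ∘ₗ mulMul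
    = mulMul ∘ₗ middle (braiding b p) ∘ₗ TensorProduct.map (braiding b p) (braiding b p)
      ∘ₗ middle (braiding b p) := by
  refine TensorProduct.ext_fourfold' fun x y z w => ?_
  simp only [LinearMap.comp_apply, middle_tmul]
  have h1 : braiding b p (mulMul ((x ⊗ₜ[F] y) ⊗ₜ[F] (z ⊗ₜ[F] w)))
      = braidHom b p x (sandwich b p w 1 (braiding b p (y ⊗ₜ z))) := by
    rw [← braidHom_mul_tmul, ← Module.End.mul_apply, ← map_mul]
    simp [mulMul, braiding_tmul]
  rw [h1]
  generalize braiding b p (y ⊗ₜ z) = Z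
  induction Z with
  | zero => simp
  | add z w hz hw => simp only [TensorProduct.add_tmul, TensorProduct.tmul_add, map_add, hz, hw]
  | tmul z y =>
    rw [sandwich_tmul, ← braiding_tmul]
    simp only [TensorProduct.assoc_tmul, TensorProduct.assoc_symm_tmul, TensorProduct.map_tmul]
    generalize braiding b p (y ⊗ₜ w) = W
    induction W with
    | zero => simp
    | add z w hz hw => simp only [TensorProduct.tmul_add, map_add, hz, hw]
    | tmul w y =>
      rw [mulMul_middle, LinearMap.rTensor_tmul, LinearMap.mulLeft_apply, braidHom_mul_tmul]

theorem isInducedBraiding_braiding : IsInducedBraiding b p (braiding b p) where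
  restrict := by
    refine TensorProduct.ext (b.ext fun i => b.ext fun j => ?_)
    have h := vecCross_basis b p i j 1
    rw [mul_one] at h
    simp [braiding_tmul, braidHom_ι, braidStep_tmul, h, vecCross_one, absorb_tmul,
      vecBraiding_basis]
  one_tmul x := by simp [braiding_tmul]
  tmul_one := braiding_tmul_one b p
  fusion := braiding_fusion b p

theorem IsInducedBraiding.tmul_mul {b : Module.Basis ι F V} {p : F}
    {c : 𝐀 ⊗[F] 𝐀 →ₗ[F] 𝐀 ⊗[F] 𝐀} (h : IsInducedBraiding b p c)
    (x z w : 𝐀) : c (x ⊗ₜ (z * w)) = mulMul (middle c (c (x ⊗ₜ z) ⊗ₜ (w ⊗ₜ 1))) := by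
  have := congrArg (fun f => f ((x ⊗ₜ[F] 1) ⊗ₜ[F] (z ⊗ₜ[F] w))) h.fusion
  simpa [middle_tmul, h.one_tmul, mulMul] using this

theorem IsInducedBraiding.mul_tmul {b : Module.Basis ι F V} {p : F}
    {c : 𝐀 ⊗[F] 𝐀 →ₗ[F] 𝐀 ⊗[F] 𝐀} (h : IsInducedBraiding b p c) (x y z : 𝐀) :
    c ((x * y) ⊗ₜ z) = mulMul (middle c (TensorProduct.map c c
      ((TensorProduct.assoc F 𝐀 𝐀 (𝐀 ⊗[F] 𝐀)).symm
        (x ⊗ₜ TensorProduct.assoc F 𝐀 𝐀 𝐀 (c (y ⊗ₜ z) ⊗ₜ 1))))) := by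
  have := congrArg (fun f => f ((x ⊗ₜ[F] y) ⊗ₜ[F] (z ⊗ₜ[F] 1))) h.fusion
  simpa [middle_tmul, mulMul] using this

theorem IsInducedBraiding.unique {b : Module.Basis ι F V} {p : F}
    {c c' : 𝐀 ⊗[F] 𝐀 →ₗ[F] 𝐀 ⊗[F] 𝐀} (h : IsInducedBraiding b p c)
    (h' : IsInducedBraiding b p c') : c = c' := by
  have step (s : 𝐀) : ∀ v : V,
      c (ExteriorAlgebra.ι F v ⊗ₜ s) = c' (ExteriorAlgebra.ι F v ⊗ₜ s) := by
    induction s using CliffordAlgebra.left_induction with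
    | algebraMap r =>
      intro v
      simp only [Algebra.algebraMap_eq_smul_one, TensorProduct.tmul_smul, map_smul, h.tmul_one,
        h'.tmul_one]
    | add x y hx hy =>
      intro v
      simp only [TensorProduct.tmul_add, map_add, hx, hy]
    | ι_mul s u hs =>
      intro v
      change c (_ ⊗ₜ (ExteriorAlgebra.ι F u * s)) = c' (_ ⊗ₜ (ExteriorAlgebra.ι F u * s))
      rw [h.tmul_mul, h'.tmul_mul]
      have e := congrArg (fun f => f (v ⊗ₜ[F] u)) h.restrict
      have e' := congrArg (fun f => f (v ⊗ₜ[F] u)) h'.restrict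
      simp only [LinearMap.comp_apply, TensorProduct.map_tmul] at e e'
      rw [e, e']
      generalize vecBraiding b p (v ⊗ₜ u) = Z
      induction Z using TensorProduct.induction_on with
      | zero => simp
      | add z w hz hw => simp only [TensorProduct.add_tmul, map_add, hz, hw]
      | tmul z x => rw [TensorProduct.map_tmul, middle_tmul, middle_tmul, hs]
  refine TensorProduct.ext' fun t s => ?_
  induction t using CliffordAlgebra.left_induction generalizing s with
  | algebraMap r =>
    simp only [Algebra.algebraMap_eq_smul_one, ← TensorProduct.smul_tmul', map_smul, h.one_tmul,
      h'.one_tmul]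
  | add x y hx hy => simp only [TensorProduct.add_tmul, map_add, hx, hy]
  | ι_mul t v ht =>
    change c ((ExteriorAlgebra.ι F v * t) ⊗ₜ s) = c' ((ExteriorAlgebra.ι F v * t) ⊗ₜ s)
    rw [h.mul_tmul, h'.mul_tmul, ht]
    generalize c' (t ⊗ₜ s) = Z
    induction Z using TensorProduct.induction_on with
    | zero => simp
    | add z w hz hw => simp only [TensorProduct.add_tmul, TensorProduct.tmul_add, map_add, hz, hw]
    | tmul z y =>
      simp only [TensorProduct.assoc_tmul, TensorProduct.assoc_symm_tmul, TensorProduct.map_tmul,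
        step, h.tmul_one, h'.tmul_one]
      generalize c' (ExteriorAlgebra.ι F v ⊗ₜ z) = W
      induction W using TensorProduct.induction_on with
      | zero => simp
      | add z w hz hw => simp only [TensorProduct.add_tmul, map_add, hz, hw]
      | tmul w u => simp only [middle_tmul, h.tmul_one, h'.tmul_one]

theorem comul_mul_apply (x : 𝐀) (z : 𝐀 ⊗[F] 𝐀) :
    comulHom b p x z = mulMul (middle (braiding b p) (comul b p x ⊗ₜ z)) := by
  rw [comul_apply]
  induction x using CliffordAlgebra.left_induction with
  | algebraMap c =>
    rw [AlgHom.commutes, Module.algebraMap_end_apply, Module.algebraMap_end_apply,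
      ← TensorProduct.smul_tmul', map_smul, map_smul]
    congr 1
    induction z with
    | zero => simp
    | add z w hz hw => simp only [TensorProduct.tmul_add, map_add, ← hz, ← hw]
    | tmul s t => rw [mulMul_middle, sandwich_tmul]; simp
  | add x y hx hy => simp only [map_add, LinearMap.add_apply, hx, hy, TensorProduct.add_tmul]
  | ι_mul x v hx =>
    change comulHom b p (ExteriorAlgebra.ι F v * x) z
      = mulMul (middle (braiding b p) (comulHom b p (ExteriorAlgebra.ι F v * x) _ ⊗ₜ z))
    rw [map_mul, Module.End.mul_apply, Module.End.mul_apply, hx, comulHom_ι]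
    clear hx
    generalize comulHom b p x (1 ⊗ₜ 1) = W
    induction z with
    | zero => simp
    | add z w hz hw => simp only [TensorProduct.tmul_add, map_add, hz, hw]
    | tmul s t =>
      rw [mulMul_middle, mulMul_middle]
      simp only [comulStep, LinearMap.add_apply, map_add, leftMul_sandwich, braidStep_sandwich]

theorem isBraidedCoproduct_comul : IsBraidedCoproduct (braiding b p) (comul b p) where
  one := by simp [comul_apply]
  primitive v := by
    rw [comul_apply, comulHom_ι, comulStep, LinearMap.add_apply, LinearMap.add_apply, leftMul_tmul, braidStep_one_tmul,
      mul_one]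
  mul := TensorProduct.ext' fun x y => by
    rw [LinearMap.comp_apply, LinearMap.mul'_apply, comul_apply, map_mul, Module.End.mul_apply,
      ← comul_apply, comul_mul_apply]
    rfl

/-- The basis vector `f_E`: the product of the basis vectors indexed by `E`, in increasing order. -/
def word (E : Finset ι) : 𝐀 := ((E.sort (· ≤ ·)).map fun i => ExteriorAlgebra.ι F (b i)).prod

/-- The projection `π_k` onto the elements of degree `k`. -/
def degProj (k : ℕ) : 𝐀 →ₗ[F] 𝐀 := GradedAlgebra.proj (fun i : ℕ => ⋀[F]^i V) k

/-- `Δ_{k)} = (π_k ⊗ id) Δ`. -/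
def comulLeft (k : ℕ) : 𝐀 →ₗ[F] 𝐀 ⊗[F] 𝐀 := LinearMap.rTensor 𝐀 (degProj k) ∘ₗ comul b p

/-- `Δ_{(k} = (id ⊗ π_k) Δ`. -/
def comulRight (k : ℕ) : 𝐀 →ₗ[F] 𝐀 ⊗[F] 𝐀 := LinearMap.lTensor 𝐀 (degProj k) ∘ₗ comul b p

/-- The ladder diagram `(∇ ⊗ id) (id ⊗ Δ_{k)})`, which moves degree `k` from right to left. -/
def ladderLeft (k : ℕ) : Module.End F (𝐀 ⊗[F] 𝐀) :=
  LinearMap.rTensor 𝐀 (LinearMap.mul' F 𝐀) ∘ₗ (TensorProduct.assoc F 𝐀 𝐀 𝐀).symm.toLinearMap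
    ∘ₗ LinearMap.lTensor 𝐀 (comulLeft b p k)

/-- The ladder diagram `(id ⊗ ∇) (Δ_{(k} ⊗ id)`, which moves degree `k` from left to right. -/
def ladderRight (k : ℕ) : Module.End F (𝐀 ⊗[F] 𝐀) :=
  LinearMap.lTensor 𝐀 (LinearMap.mul' F 𝐀) ∘ₗ (TensorProduct.assoc F 𝐀 𝐀 𝐀).toLinearMap
    ∘ₗ LinearMap.rTensor 𝐀 (comulRight b p k)

/-- The operator `L`. -/
def opL : Module.End F (𝐀 ⊗[F] 𝐀) := ladderLeft b p 1

/-- The operator `R`. -/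
def opR : Module.End F (𝐀 ⊗[F] 𝐀) := ladderRight b p 1

/-- The `q`-integer `[n]_q = 1 + q + ⋯ + q ^ (n - 1)`. -/
def qInt (q : F) (n : ℕ) : F := ∑ i ∈ Finset.range n, q ^ i

/-- The `q`-factorial `[n]_q! = [1]_q ⋯ [n]_q`. -/
def qFactorial (q : F) (n : ℕ) : F := ∏ i ∈ Finset.range n, qInt q (i + 1)

/-- The `q`-divided power `x ^ n / [n]_q!`, meaningful when `[n]_q! ≠ 0`. -/
def qDividedPower {A : Type*} [Ring A] [Algebra F A] (q : F) (x : A) (n : ℕ) : A :=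
  (qFactorial q n)⁻¹ • x ^ n

/-- The signed Gaussian exponential `(-1) ^ k q ^ (k (k - 1) / 2)`. -/
def signedGauss (q : F) (k : ℕ) : F := (-1) ^ k * q ^ (k * (k - 1) / 2)

end

end DeformedExterior

namespace DeformedExterior

noncomputable section

variable {F V ι : Type*} [Field F] [AddCommGroup V] [Module F V] [LinearOrder ι]
variable (b : Module.Basis ι F V) (p : F)

local notation "𝐀" => ExteriorAlgebra F V

/-! Regard `⋀V ⊗ ⋀V` as the braided tensor square algebra: `leftMul v` multiplies by `v ⊗ 1`,
`braidStep b p v` by `1 ⊗ v`, `braidHom b p x` by `1 ⊗ x`, and `Δ` is multiplicative. Let `S` scale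
degree `k` by `(-1)^k p^(k(k-1)/2)`. It acts as an antipode: `∑ (S(x₁) ⊗ 1) Δ(x₂) = 1 ⊗ x`
(`mulComul_antipode_comul`). This rests on `∇ τ̂ (v ⊗ s) = p^(deg s) v ∧ s` (`mulVec_vecCross`),
which matches the recursion of the scalars of `S`.

Take `x`, `y` of degrees `m`, `n`, multiply the antipode identity by `Δ(y)` and project the left
factor to degree `n`. Multiplication by `1 ⊗ x` keeps the left degree, and the part of `Δ(y)` of
left degree `n` is `y ⊗ 1`, so one side becomes `τ̂ (x ⊗ y)`. On the other side `Δ(x₂) Δ(y) = Δ(x₂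
y)`; a component `x₁` of degree `k` comes with `x₂` of degree `m - k`, and `π_n (x₁ u) = x₁
π_{n-k}(u)`. The `k`-th term is therefore the ladder `L_(n-k) R_(m-k)`. This is `braiding_of_mem`,
the graded formula.

The divided power formula then follows from `R^a = [a]! R_(a)` and `L^a = [a]! L_(a)`
(`opR_pow_apply`, `opL_pow_apply`), where the `p`-integers accumulate when `R` is moved past `v ⊗ 1`
and `L` past `1 ⊗ v`. -/

/-! ### Basis induction and degree operators -/

/-- The commutation rules of the braiding are explicit only for basis vectors, so inductions must
peel off basis vectors rather than arbitrary ones. -/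
theorem basis_induction {κ : Type*} (b : Module.Basis κ F V) {C : 𝐀 → Prop} (one : C 1)
    (add : ∀ x y, C x → C y → C (x + y))
    (smul : ∀ (c : F) x, C x → C (c • x))
    (ι_mul : ∀ i x, C x → C (ExteriorAlgebra.ι F (b i) * x)) (x : 𝐀) : C x := by
  induction x using CliffordAlgebra.left_induction with
  | algebraMap r =>
    rw [Algebra.algebraMap_eq_smul_one]
    exact smul r _ one
  | add x y hx hy => exact add x y hx hy
  | ι_mul x v hx =>
    change C (ExteriorAlgebra.ι F v * x)
    have hv : v ∈ Submodule.span F (Set.range b) := b.mem_span v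
    induction hv using Submodule.span_induction with
    | zero => simpa using smul 0 _ hx
    | add v w _ _ hv hw =>
      rw [map_add, add_mul]
      exact add _ _ hv hw
    | smul c v _ hv =>
      rw [map_smul, smul_mul_assoc]
      exact smul c _ hv
    | mem v hv =>
      obtain ⟨i, rfl⟩ := hv
      exact ι_mul i x hx

/-- The operator that acts on elements of degree `k` as the scalar `d k`. -/
def degScale (d : ℕ → F) : 𝐀 →ₗ[F] 𝐀 :=
  DirectSum.toModule F ℕ 𝐀 (fun k => d k • (⋀[F]^k V).subtype)
    ∘ₗ (DirectSum.decomposeLinearEquiv (fun k : ℕ => ⋀[F]^k V)).toLinearMap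

theorem degScale_of_mem (d : ℕ → F) {k : ℕ} {x : 𝐀} (hx : x ∈ ⋀[F]^k V) :
    degScale d x = d k • x := by
  lift x to ⋀[F]^k V using hx
  simp [degScale]

theorem ext_homogeneous {M : Type*} [AddCommGroup M] [Module F M] {f g : 𝐀 →ₗ[F] M}
    (h : ∀ (k : ℕ), ∀ x ∈ ⋀[F]^k V, f x = g x) : f = g := by
  refine LinearMap.ext fun x => ?_
  induction x using DirectSum.Decomposition.inductionOn (fun k : ℕ => ⋀[F]^k V) with
  | zero => simp
  | homogeneous x => exact h _ x x.2
  | add x y hx hy => rw [map_add, map_add, hx, hy]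

theorem degProj_of_mem {k : ℕ} {x : 𝐀} (hx : x ∈ ⋀[F]^k V) : degProj k x = x :=
  DirectSum.decompose_of_mem_same (fun i : ℕ => ⋀[F]^i V) hx

theorem degProj_of_mem_ne {j k : ℕ} (h : j ≠ k) {x : 𝐀} (hx : x ∈ ⋀[F]^k V) :
    degProj j x = 0 :=
  DirectSum.decompose_of_mem_ne (fun i : ℕ => ⋀[F]^i V) hx h.symm

theorem degProj_mem (k : ℕ) (x : 𝐀) : degProj k x ∈ ⋀[F]^k V :=
  SetLike.coe_mem _

theorem degProj_eq_degScale (k : ℕ) :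
    (degProj k : 𝐀 →ₗ[F] 𝐀) = degScale fun j => if j = k then 1 else 0 :=
  ext_homogeneous fun j x hx => by
    rw [degScale_of_mem _ hx]
    split_ifs with h
    · rw [one_smul, ← h, degProj_of_mem hx]
    · rw [zero_smul, degProj_of_mem_ne (Ne.symm h) hx]

theorem degScale_sum_smul {κ : Type*} (s : Finset κ) (c : κ → F) (d : κ → ℕ → F) :
    (degScale (fun j => ∑ k ∈ s, c k * d k j) : 𝐀 →ₗ[F] 𝐀) = ∑ k ∈ s, c k • degScale (d k) :=
  ext_homogeneous fun j x hx => by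
    simp [degScale_of_mem _ hx, Finset.sum_smul, mul_smul]

theorem ι_mul_mem (v : V) {k : ℕ} {x : 𝐀} (hx : x ∈ ⋀[F]^k V) :
    ExteriorAlgebra.ι F v * x ∈ ⋀[F]^(k + 1) V := by
  change _ ∈ LinearMap.range (ExteriorAlgebra.ι F) ^ (k + 1)
  rw [pow_succ']
  exact Submodule.mul_mem_mul (LinearMap.mem_range_self _ v) hx

theorem degScale_one (d : ℕ → F) : degScale d (1 : 𝐀) = d 0 • 1 :=
  degScale_of_mem d SetLike.GradedOne.one_mem

/-- The reason for working with arbitrary scalings instead of the projections `degProj`: the family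
is closed under this shift, so inductions that generalize `d` need no separate case for degree zero.
-/
theorem degScale_ι_mul (d : ℕ → F) (v : V) (x : 𝐀) :
    degScale d (ExteriorAlgebra.ι F v * x)
      = ExteriorAlgebra.ι F v * degScale (fun k => d (k + 1)) x :=
  congrArg (fun f : 𝐀 →ₗ[F] 𝐀 => f x) (ext_homogeneous
    (f := degScale d ∘ₗ LinearMap.mulLeft F (ExteriorAlgebra.ι F v))
    (g := LinearMap.mulLeft F (ExteriorAlgebra.ι F v) ∘ₗ degScale fun k => d (k + 1))
    fun k x hx => by
      simp [degScale_of_mem _ hx, degScale_of_mem _ (ι_mul_mem v hx)])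

theorem rTensor_degScale_mulLeft_ι {M : Type*} [AddCommGroup M] [Module F M] (d : ℕ → F) (v : V)
    (z : 𝐀 ⊗[F] M) :
    LinearMap.rTensor M (degScale d) (LinearMap.rTensor M
        (LinearMap.mulLeft F (ExteriorAlgebra.ι F v)) z)
      = LinearMap.rTensor M (LinearMap.mulLeft F (ExteriorAlgebra.ι F v))
        (LinearMap.rTensor M (degScale fun k => d (k + 1)) z) := by
  rw [← LinearMap.rTensor_comp_apply, ← LinearMap.rTensor_comp_apply]
  congr 2
  refine LinearMap.ext fun x => ?_
  exact degScale_ι_mul d v x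

/-! ### A vector crossing the exterior algebra -/

/-- In `vecCross_basis` one vector is stripped from the crossed word and exactly one is put back on
its left, so the length of that strand is preserved. -/
theorem rTensor_degScale_vecCross (d : ℕ → F) (v : V) (x : 𝐀) :
    LinearMap.rTensor V (degScale d) (vecCross b p v x) = vecCross b p v (degScale d x) := by
  induction x using basis_induction b generalizing v d with
  | one => simp [vecCross_one, degScale_one, TensorProduct.smul_tmul']
  | add x y hx hy => simp only [map_add, hx, hy]
  | smul c x hx => simp only [map_smul, hx]
  | ι_mul k x hx =>
    -- Restating the goal as an equality of linear maps in `v` reduces it to basis vectors, where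
    -- `vecCross_basis` applies.
    suffices h : LinearMap.rTensor V (degScale d)
          ∘ₗ (vecCross b p).flip (ExteriorAlgebra.ι F (b k) * x)
        = (vecCross b p).flip (degScale d (ExteriorAlgebra.ι F (b k) * x)) from
      congrArg (fun f => f v) h
    refine b.ext fun i => ?_
    simp only [LinearMap.comp_apply, LinearMap.flip_apply, degScale_ι_mul, vecCross_basis, map_sub,
      map_smul, rTensor_degScale_mulLeft_ι, hx]

/-- The product `x ⊗ v ↦ x ∧ v`. -/
def mulVec : 𝐀 ⊗[F] V →ₗ[F] 𝐀 := LinearMap.mul' F 𝐀 ∘ₗ LinearMap.lTensor 𝐀 (ExteriorAlgebra.ι F)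

theorem mulVec_tmul (x : 𝐀) (v : V) : mulVec (x ⊗ₜ v) = x * ExteriorAlgebra.ι F v := rfl

theorem mulVec_mulLeft (x : 𝐀) (z : 𝐀 ⊗[F] V) :
    mulVec (LinearMap.rTensor V (LinearMap.mulLeft F x) z) = x * mulVec z := by
  induction z with
  | zero => simp
  | add z w hz hw => simp only [map_add, hz, hw, mul_add]
  | tmul s u => simp [mulVec_tmul, mul_assoc]

/-- Each crossing of distinct basis vectors contributes, after anticommuting, the scalar `p^θ(i,k) -
1 + p^θ(k,i)`, which is `p` for either order; for equal vectors both sides vanish. -/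
theorem mulVec_vecCross (v : V) (x : 𝐀) :
    mulVec (vecCross b p v x) = ExteriorAlgebra.ι F v * degScale (p ^ ·) x := by
  induction x using basis_induction b generalizing v with
  | one => simp [vecCross_one, degScale_one, mulVec_tmul]
  | add x y hx hy => simp only [map_add, hx, hy, mul_add]
  | smul c x hx => simp only [map_smul, hx, mul_smul_comm]
  | ι_mul k x hx =>
    suffices h : mulVec ∘ₗ (vecCross b p).flip (ExteriorAlgebra.ι F (b k) * x)
        = LinearMap.mulRight F (degScale (p ^ ·) (ExteriorAlgebra.ι F (b k) * x))
          ∘ₗ ExteriorAlgebra.ι F from congrArg (fun f => f v) h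
    refine b.ext fun i => ?_
    have h1 : (degScale (fun j => p ^ (j + 1)) : 𝐀 →ₗ[F] 𝐀) = p • degScale (p ^ ·) :=
      ext_homogeneous fun j x hx => by
        simp [degScale_of_mem _ hx, smul_smul, pow_succ']
    have h2 : ExteriorAlgebra.ι F (b k) * (ExteriorAlgebra.ι F (b i) * degScale (p ^ ·) x)
        = -(ExteriorAlgebra.ι F (b i) * (ExteriorAlgebra.ι F (b k) * degScale (p ^ ·) x)) := by
      rw [← mul_assoc, ← mul_assoc, ← neg_mul,
        eq_neg_of_add_eq_zero_left (ExteriorAlgebra.ι_add_mul_swap (b k) (b i))]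
    simp only [LinearMap.comp_apply, LinearMap.flip_apply, LinearMap.mulRight_apply, degScale_ι_mul,
      vecCross_basis, map_sub, map_smul, mulVec_mulLeft, hx, h1, LinearMap.smul_apply, h2,
      mul_smul_comm]
    rcases lt_trichotomy i k with h | rfl | h
    · simp [theta, h, not_lt_of_gt h]
    · simp [← mul_assoc]
    · simp only [theta, h, if_true, not_lt_of_gt h, if_false]
      module

/-! ### Degrees in the tensor square and in the coproduct -/

theorem leftMul_eq_rTensor (v : V) :
    (leftMul v : Module.End F (𝐀 ⊗[F] 𝐀))
      = LinearMap.rTensor 𝐀 (LinearMap.mulLeft F (ExteriorAlgebra.ι F v)) := rfl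

theorem rTensor_degScale_leftMul (d : ℕ → F) (v : V) (z : 𝐀 ⊗[F] 𝐀) :
    LinearMap.rTensor 𝐀 (degScale d) (leftMul v z)
      = leftMul v (LinearMap.rTensor 𝐀 (degScale fun k => d (k + 1)) z) :=
  rTensor_degScale_mulLeft_ι d v z

theorem lTensor_leftMul (f : 𝐀 →ₗ[F] 𝐀) (v : V) (z : 𝐀 ⊗[F] 𝐀) :
    LinearMap.lTensor 𝐀 f (leftMul v z) = leftMul v (LinearMap.lTensor 𝐀 f z) := by
  simp only [leftMul_eq_rTensor, ← LinearMap.comp_apply, LinearMap.lTensor_comp_rTensor,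
    LinearMap.rTensor_comp_lTensor]

theorem rTensor_absorb (f : 𝐀 →ₗ[F] 𝐀) (t : 𝐀) (z : 𝐀 ⊗[F] V) :
    LinearMap.rTensor 𝐀 f (absorb z t) = absorb (LinearMap.rTensor V f z) t := by
  induction z with
  | zero => simp
  | add z w hz hw => simp only [map_add, LinearMap.add_apply, hz, hw]
  | tmul s u => simp [absorb_tmul]

theorem lTensor_degScale_absorb (d : ℕ → F) (t : 𝐀) (z : 𝐀 ⊗[F] V) :
    LinearMap.lTensor 𝐀 (degScale d) (absorb z t)
      = absorb z (degScale (fun k => d (k + 1)) t) := by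
  induction z with
  | zero => simp
  | add z w hz hw => simp only [map_add, LinearMap.add_apply, hz, hw]
  | tmul s u => simp [absorb_tmul, degScale_ι_mul]

theorem rTensor_degScale_braidStep (d : ℕ → F) (v : V) (z : 𝐀 ⊗[F] 𝐀) :
    LinearMap.rTensor 𝐀 (degScale d) (braidStep b p v z)
      = braidStep b p v (LinearMap.rTensor 𝐀 (degScale d) z) := by
  induction z with
  | zero => simp
  | add z w hz hw => simp only [map_add, hz, hw]
  | tmul s t =>
    simp [braidStep_tmul, rTensor_absorb, rTensor_degScale_vecCross]

theorem lTensor_degScale_braidStep (d : ℕ → F) (v : V) (z : 𝐀 ⊗[F] 𝐀) :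
    LinearMap.lTensor 𝐀 (degScale d) (braidStep b p v z)
      = braidStep b p v (LinearMap.lTensor 𝐀 (degScale fun k => d (k + 1)) z) := by
  induction z with
  | zero => simp
  | add z w hz hw => simp only [map_add, hz, hw]
  | tmul s t => simp [braidStep_tmul, lTensor_degScale_absorb]

theorem comul_one : comul b p (1 : 𝐀) = 1 ⊗ₜ 1 := by simp [comul_apply]

theorem comul_ι_mul (v : V) (x : 𝐀) : comul b p (ExteriorAlgebra.ι F v * x)
    = leftMul v (comul b p x) + braidStep b p v (comul b p x) := by
  simp [comul_apply, comulHom_ι, comulStep]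

/-- The coproduct preserves the degree. -/
theorem rTensor_degScale_comul {d e : ℕ → F} {m : ℕ} (h : ∀ i j, i + j = m → d i = e j)
    {x : 𝐀} (hx : x ∈ ⋀[F]^m V) :
    LinearMap.rTensor 𝐀 (degScale d) (comul b p x)
      = LinearMap.lTensor 𝐀 (degScale e) (comul b p x) := by
  induction m generalizing x d e with
  | zero =>
    change x ∈ LinearMap.range (ExteriorAlgebra.ι F) ^ 0 at hx
    rw [pow_zero, Submodule.mem_one] at hx
    obtain ⟨c, rfl⟩ := hx
    simp [Algebra.algebraMap_eq_smul_one, comul_one, degScale_one, TensorProduct.smul_tmul',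
      TensorProduct.tmul_smul, h 0 0 rfl, smul_comm c]
  | succ m ih =>
    change x ∈ LinearMap.range (ExteriorAlgebra.ι F) ^ (m + 1) at hx
    rw [pow_succ'] at hx
    induction hx using Submodule.mul_induction_on' with
    | add x _ y _ hx hy => simp only [map_add, hx, hy]
    | mem_mul_mem v hv x hx =>
      obtain ⟨v, rfl⟩ := hv
      simp only [comul_ι_mul, map_add, rTensor_degScale_leftMul, lTensor_leftMul,
        rTensor_degScale_braidStep, lTensor_degScale_braidStep]
      -- The new vector lands in the left factor in one summand and in the right factor in the
      -- other, so the induction hypothesis is used once with `d` shifted and once with `e` shifted.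
      rw [ih (e := e) (fun i j hij => h (i + 1) j (by omega)) hx,
        ih (e := fun k => e (k + 1)) (fun i j hij => h i (j + 1) (by omega)) hx]

/-! ### The antipode identity -/

theorem signedGauss_succ (k : ℕ) : signedGauss p (k + 1) = -(p ^ k * signedGauss p k) := by
  have h : (k + 1) * (k + 1 - 1) / 2 = k + k * (k - 1) / 2 := by
    rw [Nat.triangle_succ, add_comm]
  rw [signedGauss, signedGauss, h]
  ring

/-- The antipode of the deformed exterior algebra. -/
def antipode : 𝐀 →ₗ[F] 𝐀 := degScale (signedGauss p)

theorem antipode_ι_mul (v : V) (x : 𝐀) : antipode p (ExteriorAlgebra.ι F v * x)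
    = -(ExteriorAlgebra.ι F v * degScale (p ^ ·) (antipode p x)) := by
  have h : (degScale (fun k => signedGauss p (k + 1)) : 𝐀 →ₗ[F] 𝐀)
      = -(degScale (p ^ ·) ∘ₗ antipode p) := ext_homogeneous fun j x hx => by
    simp [degScale_of_mem _ hx, antipode, signedGauss_succ, smul_smul, mul_comm]
  rw [antipode, degScale_ι_mul, h]
  simp [antipode]

/-- `y ⊗ t ↦ (y ⊗ 1) Δ(t) z`. -/
def mulComul (z : 𝐀 ⊗[F] 𝐀) : 𝐀 ⊗[F] 𝐀 →ₗ[F] 𝐀 ⊗[F] 𝐀 :=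
  TensorProduct.lift (LinearMap.compl₂ (LinearMap.rTensorHom 𝐀 ∘ₗ LinearMap.mul F 𝐀)
    (LinearMap.applyₗ z ∘ₗ (comulHom b p).toLinearMap))

theorem mulComul_tmul (z : 𝐀 ⊗[F] 𝐀) (y t : 𝐀) : mulComul b p z (y ⊗ₜ t)
    = LinearMap.rTensor 𝐀 (LinearMap.mulLeft F y) (comulHom b p t z) := rfl

theorem rTensor_mulLeft_add (x y : 𝐀) (z : 𝐀 ⊗[F] 𝐀) :
    LinearMap.rTensor 𝐀 (LinearMap.mulLeft F (x + y)) z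
      = LinearMap.rTensor 𝐀 (LinearMap.mulLeft F x) z
        + LinearMap.rTensor 𝐀 (LinearMap.mulLeft F y) z := by
  have h : LinearMap.mulLeft F (x + y) = LinearMap.mulLeft F x + LinearMap.mulLeft F y :=
    LinearMap.ext fun z => add_mul x y z
  rw [h, LinearMap.rTensor_add, LinearMap.add_apply]

theorem rTensor_mulLeft_mul (x y : 𝐀) (z : 𝐀 ⊗[F] 𝐀) :
    LinearMap.rTensor 𝐀 (LinearMap.mulLeft F (x * y)) z
      = LinearMap.rTensor 𝐀 (LinearMap.mulLeft F x)
        (LinearMap.rTensor 𝐀 (LinearMap.mulLeft F y) z) := by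
  rw [← LinearMap.rTensor_comp_apply, LinearMap.mulLeft_mul]

/-- The two summands come from `Δ(v t) = (v ⊗ 1 + 1 ⊗ v) Δ(t)`. -/
theorem mulComul_absorb (z : 𝐀 ⊗[F] 𝐀) (t : 𝐀) (w : 𝐀 ⊗[F] V) :
    mulComul b p z (absorb w t)
      = LinearMap.rTensor 𝐀 (LinearMap.mulLeft F (mulVec w)) (comulHom b p t z)
        + sandwichVec b p (comulHom b p t z) w := by
  induction w with
  | zero =>
    have h : LinearMap.mulLeft F (0 : 𝐀) = 0 := LinearMap.ext fun z => zero_mul z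
    simp [h]
  | add w w' h h' =>
    simp only [map_add, LinearMap.add_apply, h, h', rTensor_mulLeft_add]
    abel
  | tmul y v =>
    rw [absorb_tmul, mulComul_tmul, map_mul, Module.End.mul_apply, comulHom_ι, comulStep,
      LinearMap.add_apply, LinearMap.add_apply, map_add, mulVec_tmul, rTensor_mulLeft_mul,
      sandwichVec_tmul, leftMul_eq_rTensor]

/-- For `w = s ⊗ t` write `τ̂ (v ⊗ s) = ∑ s' ⊗ v'`. The terms `S(s') v'` sum to `v` times the
`p^deg`-scaling of `S(s)`, which cancels `S(v s)`. The remaining terms `(S(s') ⊗ 1)(1 ⊗ v')`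
reassemble to `(1 ⊗ v)(S(s) ⊗ 1)`. -/
theorem mulComul_antipode_step (z w : 𝐀 ⊗[F] 𝐀) (v : V) :
    mulComul b p z (LinearMap.rTensor 𝐀 (antipode p) (leftMul v w + braidStep b p v w))
      = braidStep b p v (mulComul b p z (LinearMap.rTensor 𝐀 (antipode p) w)) := by
  induction w with
  | zero => simp
  | add w w' h h' =>
    simp only [map_add] at h h' ⊢
    rw [← h, ← h']
    abel
  | tmul s t =>
    have h : LinearMap.rTensor V (antipode p) (vecCross b p v s)
        = vecCross b p v (antipode p s) := rTensor_degScale_vecCross b p _ v s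
    rw [map_add, map_add, leftMul_tmul, LinearMap.rTensor_tmul, LinearMap.rTensor_tmul,
      braidStep_tmul, rTensor_absorb, h, mulComul_absorb, mulComul_tmul, mulComul_tmul,
      braidStep_mulLeft, mulVec_vecCross, ← add_assoc, ← rTensor_mulLeft_add, antipode_ι_mul,
      neg_add_cancel]
    have h : LinearMap.mulLeft F (0 : 𝐀) = 0 := LinearMap.ext fun z => zero_mul z
    simp [h]

/-- The antipode identity: `∑ (S(x₁) ⊗ 1) Δ(x₂) = 1 ⊗ x`, acting on `z`. -/
theorem mulComul_antipode_comul (z : 𝐀 ⊗[F] 𝐀) (x : 𝐀) :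
    mulComul b p z (LinearMap.rTensor 𝐀 (antipode p) (comul b p x)) = braidHom b p x z := by
  induction x using basis_induction b with
  | one =>
    have h : LinearMap.mulLeft F (1 : 𝐀) = LinearMap.id := LinearMap.ext fun z => one_mul z
    simp [comul_one, antipode, degScale_one, signedGauss, mulComul_tmul, h]
  | add x y hx hy => simp only [map_add, LinearMap.add_apply, hx, hy]
  | smul c x hx => simp only [map_smul, LinearMap.smul_apply, hx]
  | ι_mul i x hx =>
    rw [comul_ι_mul, mulComul_antipode_step, hx, map_mul, braidHom_ι, Module.End.mul_apply]

/-! ### The ladder expansion of the braiding -/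

theorem rTensor_degScale_braidHom (d : ℕ → F) (x : 𝐀) (z : 𝐀 ⊗[F] 𝐀) :
    LinearMap.rTensor 𝐀 (degScale d) (braidHom b p x z)
      = braidHom b p x (LinearMap.rTensor 𝐀 (degScale d) z) := by
  induction x using basis_induction b with
  | one => simp
  | add x y hx hy => simp only [map_add, LinearMap.add_apply, hx, hy]
  | smul c x hx => simp only [map_smul, LinearMap.smul_apply, hx]
  | ι_mul i x hx =>
    rw [map_mul, Module.End.mul_apply, braidHom_ι, rTensor_degScale_braidStep, hx,
      Module.End.mul_apply]

/-- Multiplication by `1 ⊗ v` raises the right degree, so only the `leftMul` summands survive: this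
is the counit law. -/
theorem lTensor_degProj_zero_comul (x : 𝐀) :
    LinearMap.lTensor 𝐀 (degProj 0) (comul b p x) = x ⊗ₜ 1 := by
  rw [degProj_eq_degScale]
  have h0 : (degScale (fun _ => 0) : 𝐀 →ₗ[F] 𝐀) = 0 := ext_homogeneous fun j x hx => by
    simp [degScale_of_mem _ hx]
  induction x using basis_induction b with
  | one => simp [comul_one, degScale_one]
  | add x y hx hy => simp only [map_add, TensorProduct.add_tmul, hx, hy]
  | smul c x hx => simp only [map_smul, TensorProduct.smul_tmul', hx]
  | ι_mul i x hx =>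
    rw [comul_ι_mul, map_add, lTensor_leftMul, hx, lTensor_degScale_braidStep, leftMul_tmul]
    simp [h0]

theorem rTensor_degProj_comul_self {n : ℕ} {x : 𝐀} (hx : x ∈ ⋀[F]^n V) :
    LinearMap.rTensor 𝐀 (degProj n) (comul b p x) = x ⊗ₜ 1 := by
  rw [← lTensor_degProj_zero_comul b p x, degProj_eq_degScale, degProj_eq_degScale]
  refine rTensor_degScale_comul b p (fun i j hij => ?_) hx
  have : i = n ↔ j = 0 := by omega
  simp [this]

theorem ladderLeft_tmul (k : ℕ) (x y : 𝐀) : ladderLeft b p k (x ⊗ₜ y)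
    = LinearMap.rTensor 𝐀 (LinearMap.mulLeft F x) (comulLeft b p k y) := by
  simp only [ladderLeft, LinearMap.comp_apply, LinearMap.lTensor_tmul, LinearEquiv.coe_coe]
  generalize comulLeft b p k y = z
  induction z with
  | zero => simp
  | add z w hz hw => simp only [TensorProduct.tmul_add, map_add, hz, hw]
  | tmul s t => simp

theorem ladderRight_tmul (k : ℕ) (x y : 𝐀) : ladderRight b p k (x ⊗ₜ y)
    = LinearMap.lTensor 𝐀 (LinearMap.mulRight F y) (comulRight b p k x) := by
  simp only [ladderRight, LinearMap.comp_apply, LinearMap.rTensor_tmul, LinearEquiv.coe_coe]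
  generalize comulRight b p k x = z
  induction z with
  | zero => simp
  | add z w hz hw => simp only [TensorProduct.add_tmul, map_add, hz, hw]
  | tmul s t => simp

theorem degProj_mul_of_le {k n : ℕ} (h : k ≤ n) {x : 𝐀} (hx : x ∈ ⋀[F]^k V) (y : 𝐀) :
    degProj n (x * y) = x * degProj (n - k) y :=
  DirectSum.coe_decompose_mul_of_left_mem_of_le (fun i : ℕ => ⋀[F]^i V) hx h

theorem degProj_mul_of_lt {k n : ℕ} (h : n < k) {x : 𝐀} (hx : x ∈ ⋀[F]^k V) (y : 𝐀) :
    degProj n (x * y) = 0 :=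
  DirectSum.coe_decompose_mul_of_left_mem_of_not_le (fun i : ℕ => ⋀[F]^i V) hx h.not_ge

/-- With `s` of degree `k`, `(s ⊗ 1) Δ(t) Δ(y) = (s ⊗ 1) Δ(t y)`, and projecting a product with `s`
to degree `n` means projecting the other factor to degree `n - k`. -/
theorem rTensor_degProj_mulComul_of_le {k n : ℕ} (h : k ≤ n) (y : 𝐀) (z : 𝐀 ⊗[F] 𝐀) :
    LinearMap.rTensor 𝐀 (degProj n)
        (mulComul b p (comul b p y) (LinearMap.rTensor 𝐀 (degProj k) z))
      = ladderLeft b p (n - k) (LinearMap.lTensor 𝐀 (LinearMap.mulRight F y)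
        (LinearMap.rTensor 𝐀 (degProj k) z)) := by
  induction z with
  | zero => simp
  | add z w hz hw => simp only [map_add, hz, hw]
  | tmul s t =>
    rw [LinearMap.rTensor_tmul, mulComul_tmul, LinearMap.lTensor_tmul, ladderLeft_tmul, comulLeft,
      LinearMap.comp_apply, LinearMap.mulRight_apply, comul_apply, comul_apply, map_mul,
      Module.End.mul_apply, ← LinearMap.rTensor_comp_apply, ← LinearMap.rTensor_comp_apply]
    congr 2
    exact LinearMap.ext fun u => degProj_mul_of_le h (degProj_mem k s) u

theorem rTensor_degProj_mulComul_of_lt {k n : ℕ} (h : n < k) (w z : 𝐀 ⊗[F] 𝐀) :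
    LinearMap.rTensor 𝐀 (degProj n) (mulComul b p w (LinearMap.rTensor 𝐀 (degProj k) z)) = 0 := by
  induction z with
  | zero => simp
  | add z w hz hw => simp only [map_add, hz, hw, add_zero]
  | tmul s t =>
    rw [LinearMap.rTensor_tmul, mulComul_tmul, ← LinearMap.rTensor_comp_apply]
    have : degProj n ∘ₗ LinearMap.mulLeft F (degProj k s) = 0 :=
      LinearMap.ext fun u => degProj_mul_of_lt h (degProj_mem k s) u
    simp [this]

theorem rTensor_antipode_comul {m : ℕ} {x : 𝐀} (hx : x ∈ ⋀[F]^m V) :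
    LinearMap.rTensor 𝐀 (antipode p) (comul b p x) = ∑ k ∈ Finset.range (m + 1),
      signedGauss p k • LinearMap.rTensor 𝐀 (degProj k) (comul b p x) := by
  -- The scaling is moved to the right factor and back, since only its values at `i ≤ m` matter
  -- there; this allows replacing it by a finite combination of projections.
  rw [antipode, rTensor_degScale_comul b p (e := fun j => signedGauss p (m - j))
    (fun i j hij => by rw [← hij, Nat.add_sub_cancel]) hx,
    ← rTensor_degScale_comul b p (d := fun j => ∑ k ∈ Finset.range (m + 1),
      signedGauss p k * if j = k then 1 else 0) (fun i j hij => by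
        simp [← hij]) hx, degScale_sum_smul]
  simp [degProj_eq_degScale, LinearMap.rTensor, ← TensorProduct.mapBilinear_apply]

theorem braiding_of_mem {m n : ℕ} {x y : 𝐀} (hx : x ∈ ⋀[F]^m V) (hy : y ∈ ⋀[F]^n V) :
    braiding b p (x ⊗ₜ y) = ∑ k ∈ Finset.range (min m n + 1),
      signedGauss p k • ladderLeft b p (n - k) (ladderRight b p (m - k) (x ⊗ₜ y)) := by
  -- Acting on `Δ(y)` and keeping left degree `n` isolates `y ⊗ 1`, which turns `1 ⊗ x` into the
  -- braiding.
  have h := congrArg (LinearMap.rTensor 𝐀 (degProj n))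
    (mulComul_antipode_comul b p (comul b p y) x)
  rw [degProj_eq_degScale, rTensor_degScale_braidHom, ← degProj_eq_degScale,
    rTensor_degProj_comul_self b p hy, ← braiding_tmul] at h
  rw [← h, rTensor_antipode_comul b p hx]
  simp only [map_sum, map_smul]
  have hs : Finset.range (min m n + 1) ⊆ Finset.range (m + 1) :=
    Finset.range_mono (by omega)
  -- For `k > n` the left factor already has degree above `n`, so those terms vanish.
  rw [← Finset.sum_subset hs fun k hk hk' => by
    simp only [Finset.mem_range] at hk hk'
    rw [rTensor_degProj_mulComul_of_lt b p (by omega), smul_zero]]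
  refine Finset.sum_congr rfl fun k hk => ?_
  rw [Finset.mem_range] at hk
  rw [rTensor_degProj_mulComul_of_le b p (by omega), ladderRight_tmul, comulRight,
    LinearMap.comp_apply, degProj_eq_degScale, degProj_eq_degScale,
    -- In `Δ(x)`, left degree `k` is the same as right degree `m - k`, which produces the right
    -- ladder.
    rTensor_degScale_comul b p (e := fun j => if j = m - k then 1 else 0) (fun i j hij => ?_) hx]
  have : i = k ↔ j = m - k := by omega
  simp [this]

/-! ### Powers of `R` -/

theorem degProj_zero_ι_mul (v : V) (x : 𝐀) :
    degProj 0 (ExteriorAlgebra.ι F v * x) = 0 := by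
  have h0 : (degScale (fun _ => 0) : 𝐀 →ₗ[F] 𝐀) = 0 := ext_homogeneous fun j x hx => by
    simp [degScale_of_mem _ hx]
  simp [degProj_eq_degScale, degScale_ι_mul, h0]

theorem degProj_one (k : ℕ) : degProj k (1 : 𝐀) = if k = 0 then 1 else 0 := by
  simp [degProj_eq_degScale, degScale_one, eq_comm]

theorem tensor_basis_induction {C : 𝐀 ⊗[F] 𝐀 → Prop} (one_tmul : ∀ y, C (1 ⊗ₜ y))
    (add : ∀ z w, C z → C w → C (z + w)) (smul : ∀ (c : F) z, C z → C (c • z))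
    (leftMul : ∀ i z, C z → C (DeformedExterior.leftMul (b i) z)) (z : 𝐀 ⊗[F] 𝐀) : C z := by
  induction z with
  | zero => simpa using smul 0 _ (one_tmul 0)
  | add z w hz hw => exact add z w hz hw
  | tmul x y =>
    induction x using basis_induction b with
    | one => exact one_tmul y
    | add x x' hx hx' =>
      rw [TensorProduct.add_tmul]
      exact add _ _ hx hx'
    | smul c x hx =>
      rw [← TensorProduct.smul_tmul']
      exact smul _ _ hx
    | ι_mul i x hx => exact leftMul i _ hx

theorem ladderRight_one_tmul (k : ℕ) (y : 𝐀) :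
    ladderRight b p k (1 ⊗ₜ y) = if k = 0 then 1 ⊗ₜ y else 0 := by
  rw [ladderRight_tmul, comulRight, LinearMap.comp_apply, comul_one, LinearMap.lTensor_tmul,
    degProj_one]
  split_ifs <;> simp

theorem lTensor_mulRight_braidStep (v : V) (y : 𝐀) (z : 𝐀 ⊗[F] 𝐀) :
    LinearMap.lTensor 𝐀 (LinearMap.mulRight F y) (braidStep b p v z)
      = braidStep b p v (LinearMap.lTensor 𝐀 (LinearMap.mulRight F y) z) := by
  rw [← braidHom_ι, braidHom_mulRight]

theorem lTensor_degProj_succ_braidStep (k : ℕ) (v : V) (z : 𝐀 ⊗[F] 𝐀) :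
    LinearMap.lTensor 𝐀 (degProj (k + 1)) (braidStep b p v z)
      = braidStep b p v (LinearMap.lTensor 𝐀 (degProj k) z) := by
  simp [degProj_eq_degScale, lTensor_degScale_braidStep]

theorem ladderRight_succ_leftMul (k : ℕ) (v : V) (z : 𝐀 ⊗[F] 𝐀) :
    ladderRight b p (k + 1) (leftMul v z)
      = leftMul v (ladderRight b p (k + 1) z) + braidStep b p v (ladderRight b p k z) := by
  induction z with
  | zero => simp
  | add z w hz hw => simp only [map_add, hz, hw]; abel
  | tmul x y =>
    simp only [leftMul_tmul, ladderRight_tmul, comulRight, LinearMap.comp_apply, comul_ι_mul,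
      map_add, lTensor_leftMul, lTensor_degProj_succ_braidStep, lTensor_mulRight_braidStep]

theorem ladderRight_zero : ladderRight b p 0 = 1 :=
  TensorProduct.ext' fun x y => by
    rw [ladderRight_tmul, comulRight, LinearMap.comp_apply, lTensor_degProj_zero_comul]
    simp

theorem opR_leftMul (v : V) (z : 𝐀 ⊗[F] 𝐀) :
    opR b p (leftMul v z) = leftMul v (opR b p z) + braidStep b p v z := by
  rw [opR, ladderRight_succ_leftMul, ladderRight_zero, Module.End.one_apply]

theorem opR_one_tmul (y : 𝐀) : opR b p (1 ⊗ₜ y) = 0 := by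
  simp [opR, ladderRight_one_tmul]

/-- Both sides vanish on `1 ⊗ y`. Moving a factor `leftMul (b k)` outwards then uses the exchange
rule and the anticommutation of the `braidStep` operators. -/
theorem opR_braidStep (v : V) (z : 𝐀 ⊗[F] 𝐀) :
    opR b p (braidStep b p v z) = p • braidStep b p v (opR b p z) := by
  induction z using tensor_basis_induction b generalizing v with
  | one_tmul y => simp [braidStep_one_tmul, opR_one_tmul]
  | add z w hz hw => simp only [map_add, hz, hw, smul_add]
  | smul c z hz => simp only [map_smul, hz, smul_comm c]
  | leftMul k z hz =>
    suffices h : LinearMap.applyₗ (leftMul (b k) z) ∘ₗ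
          (LinearMap.mulLeft F (opR b p) ∘ₗ braidStep b p)
        = p • (LinearMap.applyₗ (opR b p (leftMul (b k) z)) ∘ₗ braidStep b p) from
      congrArg (fun f => f v) h
    refine b.ext fun i => ?_
    have h1 : braidStep b p (b k) (braidStep b p (b i) z)
        = -braidStep b p (b i) (braidStep b p (b k) z) :=
      eq_neg_of_add_eq_zero_left
        (congrArg (fun f : Module.End F (𝐀 ⊗[F] 𝐀) => f z) (braidStep_anticomm b p k i))
    have h2 : braidStep b p (b i) (braidStep b p (b i) z) = 0 :=
      congrArg (fun f : Module.End F (𝐀 ⊗[F] 𝐀) => f z) (braidStep_sq_basis b p i)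
    simp only [LinearMap.comp_apply, LinearMap.smul_apply, LinearMap.applyₗ_apply_apply,
      LinearMap.add_apply, LinearMap.mulLeft_apply, Module.End.mul_apply, opR_leftMul, map_add,
      map_sub, map_smul, hz, braidStep_leftMul_apply, h1]
    -- The order of `i` and `k` fixes both exponents; what remains is a linear identity, with the
    -- square of `braidStep` vanishing when `i = k`.
    rcases lt_trichotomy i k with h | rfl | h
    · simp only [theta, h, if_true, not_lt_of_gt h, if_false]
      module
    · simp only [h2, theta, lt_irrefl, if_false]
      module
    · simp only [theta, h, if_true, not_lt_of_gt h, if_false]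
      module

theorem qInt_succ (n : ℕ) : qInt p (n + 1) = 1 + p * qInt p n := by
  simp only [qInt, Finset.sum_range_succ', pow_succ', ← Finset.mul_sum, pow_zero, add_comm]

theorem qInt_succ' (n : ℕ) : qInt p (n + 1) = qInt p n + p ^ n := by
  simp only [qInt, Finset.sum_range_succ]

theorem qFactorial_succ (n : ℕ) : qFactorial p (n + 1) = qFactorial p n * qInt p (n + 1) := by
  simp only [qFactorial, Finset.prod_range_succ]

/-- A `p`-Leibniz rule: moving `R` past `1 ⊗ v` costs `p`, so the coefficient obeys `[n+1] = 1 + p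
[n]`. -/
theorem opR_pow_succ_leftMul (a : ℕ) (v : V) (z : 𝐀 ⊗[F] 𝐀) :
    (opR b p ^ (a + 1)) (leftMul v z) = leftMul v ((opR b p ^ (a + 1)) z)
      + qInt p (a + 1) • braidStep b p v ((opR b p ^ a) z) := by
  induction a with
  | zero => simp [opR_leftMul, qInt]
  | succ a ih =>
    simp only [pow_succ' _ (a + 1), Module.End.mul_apply, ih, map_add, opR_leftMul, map_smul,
      opR_braidStep, qInt_succ p (a + 1)]
    rw [pow_succ', Module.End.mul_apply]
    module

/-- The Leibniz rule and `ladderRight_succ_leftMul` are the same recursion up to the factor `[a+1]`.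
No factorial is inverted, so roots of unity cause no trouble. -/
theorem opR_pow_apply (a : ℕ) (z : 𝐀 ⊗[F] 𝐀) :
    (opR b p ^ a) z = qFactorial p a • ladderRight b p a z := by
  induction z using tensor_basis_induction b generalizing a with
  | one_tmul y =>
    cases a with
    | zero => simp [ladderRight_zero, qFactorial]
    | succ a => simp [pow_succ, opR_one_tmul, ladderRight_one_tmul]
  | add z w hz hw => simp only [map_add, hz, hw, smul_add]
  | smul c z hz => simp only [map_smul, hz, smul_comm c]
  | leftMul i z hz =>
    cases a with
    | zero => simp [ladderRight_zero, qFactorial]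
    | succ a =>
      rw [opR_pow_succ_leftMul, hz, hz, ladderRight_succ_leftMul, qFactorial_succ]
      simp only [map_smul]
      module

/-! ### Powers of `L` -/

theorem comulLeft_one (k : ℕ) :
    comulLeft b p k (1 : 𝐀) = if k = 0 then 1 ⊗ₜ 1 else 0 := by
  rw [comulLeft, LinearMap.comp_apply, comul_one, LinearMap.rTensor_tmul, degProj_one]
  split_ifs <;> simp

theorem rTensor_degProj_succ_leftMul (k : ℕ) (v : V) (z : 𝐀 ⊗[F] 𝐀) :
    LinearMap.rTensor 𝐀 (degProj (k + 1)) (leftMul v z)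
      = leftMul v (LinearMap.rTensor 𝐀 (degProj k) z) := by
  simp [degProj_eq_degScale, rTensor_degScale_leftMul]

theorem rTensor_degProj_zero_leftMul (v : V) (z : 𝐀 ⊗[F] 𝐀) :
    LinearMap.rTensor 𝐀 (degProj 0) (leftMul v z) = 0 := by
  rw [leftMul_eq_rTensor, ← LinearMap.rTensor_comp_apply]
  have : degProj 0 ∘ₗ LinearMap.mulLeft F (ExteriorAlgebra.ι F v) = 0 :=
    LinearMap.ext fun x => degProj_zero_ι_mul v x
  simp [this]

theorem comulLeft_zero (x : 𝐀) : comulLeft b p 0 x = 1 ⊗ₜ x := by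
  induction x using basis_induction b with
  | one => simp [comulLeft_one]
  | add x y hx hy => rw [map_add, hx, hy, TensorProduct.tmul_add]
  | smul c x hx => rw [map_smul, hx, TensorProduct.tmul_smul]
  | ι_mul i x hx =>
    rw [comulLeft, LinearMap.comp_apply] at hx ⊢
    rw [comul_ι_mul, map_add, rTensor_degProj_zero_leftMul, zero_add, degProj_eq_degScale,
      rTensor_degScale_braidStep, ← degProj_eq_degScale, hx, braidStep_one_tmul]

theorem ladderLeft_zero : ladderLeft b p 0 = 1 :=
  TensorProduct.ext' fun x y => by
    rw [ladderLeft_tmul, comulLeft_zero]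
    simp

theorem comulLeft_succ_ι_mul (k : ℕ) (v : V) (x : 𝐀) :
    comulLeft b p (k + 1) (ExteriorAlgebra.ι F v * x)
      = leftMul v (comulLeft b p k x) + braidStep b p v (comulLeft b p (k + 1) x) := by
  simp only [comulLeft, LinearMap.comp_apply, comul_ι_mul, map_add, rTensor_degProj_succ_leftMul]
  rw [degProj_eq_degScale (k + 1), rTensor_degScale_braidStep]

theorem ladderLeft_succ_absorb (k : ℕ) (y : 𝐀) (z : 𝐀 ⊗[F] V) :
    ladderLeft b p (k + 1) (absorb z y) = ladderLeft b p k (mulVec z ⊗ₜ y)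
      + sandwichVec b p (comulLeft b p (k + 1) y) z := by
  induction z with
  | zero => simp
  | add z w hz hw =>
    simp only [map_add, LinearMap.add_apply, TensorProduct.add_tmul, hz, hw]
    abel
  | tmul x v =>
    rw [absorb_tmul, ladderLeft_tmul, comulLeft_succ_ι_mul, map_add, leftMul_eq_rTensor,
      ← rTensor_mulLeft_mul, mulVec_tmul, ladderLeft_tmul, sandwichVec_tmul]

theorem ladderLeft_leftMul (k : ℕ) (v : V) (z : 𝐀 ⊗[F] 𝐀) :
    ladderLeft b p k (leftMul v z) = leftMul v (ladderLeft b p k z) := by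
  induction z with
  | zero => simp
  | add z w hz hw => simp only [map_add, hz, hw]
  | tmul x y =>
    rw [leftMul_tmul, ladderLeft_tmul, ladderLeft_tmul, rTensor_mulLeft_mul, leftMul_eq_rTensor]

/-- The ladder carries degree `k + 1` to the left; the extra term is the part where `v` itself is
carried back after crossing, and `mulVec_vecCross` evaluates it, whence the `p^deg` scaling. -/
theorem ladderLeft_succ_braidStep (k : ℕ) (v : V) (z : 𝐀 ⊗[F] 𝐀) :
    ladderLeft b p (k + 1) (braidStep b p v z) = braidStep b p v (ladderLeft b p (k + 1) z)
      + leftMul v (ladderLeft b p k (LinearMap.rTensor 𝐀 (degScale (p ^ ·)) z)) := by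
  induction z with
  | zero => simp
  | add z w hz hw => simp only [map_add, hz, hw]; abel
  | tmul x y =>
    rw [braidStep_tmul, ladderLeft_succ_absorb, mulVec_vecCross, LinearMap.rTensor_tmul,
      ← ladderLeft_leftMul, leftMul_tmul, ladderLeft_tmul b p (k + 1), braidStep_mulLeft, add_comm]

theorem opL_leftMul (v : V) (z : 𝐀 ⊗[F] 𝐀) :
    opL b p (leftMul v z) = leftMul v (opL b p z) := ladderLeft_leftMul b p 1 v z

theorem opL_braidStep (v : V) (z : 𝐀 ⊗[F] 𝐀) :
    opL b p (braidStep b p v z) = braidStep b p v (opL b p z)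
      + leftMul v (LinearMap.rTensor 𝐀 (degScale (p ^ ·)) z) := by
  rw [opL, ladderLeft_succ_braidStep, ladderLeft_zero, Module.End.one_apply]

theorem degScale_pow_mul_of_mem {k : ℕ} {u : 𝐀} (hu : u ∈ ⋀[F]^k V) (x : 𝐀) :
    degScale (p ^ ·) (x * u) = p ^ k • (degScale (p ^ ·) x * u) := by
  suffices h : degScale (p ^ ·) ∘ₗ LinearMap.mulRight F u
      = p ^ k • (LinearMap.mulRight F u ∘ₗ degScale (p ^ ·)) from congrArg (fun f => f x) h
  refine ext_homogeneous fun j x hx => ?_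
  have h : x * u ∈ ⋀[F]^(j + k) V := SetLike.GradedMul.mul_mem hx hu
  simp [degScale_of_mem _ hx, degScale_of_mem _ h, smul_smul, pow_add, mul_comm]

/-- The ladder raises the left degree by exactly `k`. -/
theorem rTensor_degScale_pow_ladderLeft (k : ℕ) (z : 𝐀 ⊗[F] 𝐀) :
    LinearMap.rTensor 𝐀 (degScale (p ^ ·)) (ladderLeft b p k z)
      = p ^ k • ladderLeft b p k (LinearMap.rTensor 𝐀 (degScale (p ^ ·)) z) := by
  induction z with
  | zero => simp
  | add z w hz hw => simp only [map_add, hz, hw, smul_add]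
  | tmul x y =>
    rw [LinearMap.rTensor_tmul, ladderLeft_tmul, ladderLeft_tmul, comulLeft, LinearMap.comp_apply]
    generalize comul b p y = z
    induction z with
    | zero => simp
    | add z w hz hw => simp only [map_add, hz, hw, smul_add]
    | tmul s t =>
      simp [degScale_pow_mul_of_mem p (degProj_mem k s), TensorProduct.smul_tmul']

theorem rTensor_degScale_pow_opL_pow (a : ℕ) (z : 𝐀 ⊗[F] 𝐀) :
    LinearMap.rTensor 𝐀 (degScale (p ^ ·)) ((opL b p ^ a) z)
      = p ^ a • (opL b p ^ a) (LinearMap.rTensor 𝐀 (degScale (p ^ ·)) z) := by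
  induction a with
  | zero => simp
  | succ a ih =>
    rw [pow_succ', Module.End.mul_apply, Module.End.mul_apply, opL,
      rTensor_degScale_pow_ladderLeft, ← opL, ih, map_smul, smul_smul, pow_one, ← pow_succ']

/-- Here the powers of `p` arise from moving the scaling past `L^a`, so the coefficient obeys `[n+1]
= [n] + p^n`. -/
theorem opL_pow_succ_braidStep (a : ℕ) (v : V) (z : 𝐀 ⊗[F] 𝐀) :
    (opL b p ^ (a + 1)) (braidStep b p v z) = braidStep b p v ((opL b p ^ (a + 1)) z)
      + qInt p (a + 1) • leftMul v ((opL b p ^ a)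
        (LinearMap.rTensor 𝐀 (degScale (p ^ ·)) z)) := by
  induction a with
  | zero => simp [opL_braidStep, qInt]
  | succ a ih =>
    simp only [pow_succ' _ (a + 1), Module.End.mul_apply, ih, map_add, opL_braidStep, map_smul,
      opL_leftMul, rTensor_degScale_pow_opL_pow, qInt_succ' p (a + 1)]
    rw [pow_succ' _ a, Module.End.mul_apply]
    module

theorem opL_pow_apply (a : ℕ) (z : 𝐀 ⊗[F] 𝐀) :
    (opL b p ^ a) z = qFactorial p a • ladderLeft b p a z := by
  induction z using tensor_basis_induction b generalizing a with
  | one_tmul y =>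
    induction y using basis_induction b generalizing a with
    | one =>
      cases a with
      | zero => simp [ladderLeft_zero, qFactorial]
      | succ a => simp [pow_succ, opL, ladderLeft_tmul, comulLeft_one]
    | add x y hx hy => simp only [TensorProduct.tmul_add, map_add, hx, hy, smul_add]
    | smul c x hx => simp only [TensorProduct.tmul_smul, map_smul, hx, smul_comm c]
    | ι_mul i y hy =>
      -- `L` commutes with `leftMul`, so only `1 ⊗ y` matters; its leading vector is exposed as a
      -- `braidStep`, and the scaling acts trivially on the left factor `1`.
      rw [← braidStep_one_tmul b p]
      cases a with
      | zero => simp [ladderLeft_zero, qFactorial]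
      | succ a =>
        rw [opL_pow_succ_braidStep, hy, ladderLeft_succ_braidStep, LinearMap.rTensor_tmul,
          degScale_one, pow_zero, one_smul, hy, qFactorial_succ]
        simp only [map_smul]
        module
  | add z w hz hw => simp only [map_add, hz, hw, smul_add]
  | smul c z hz => simp only [map_smul, hz, smul_comm c]
  | leftMul i z hz =>
    have h : ∀ a, (opL b p ^ a) (leftMul (b i) z) = leftMul (b i) ((opL b p ^ a) z) := by
      intro a
      induction a with
      | zero => simp
      | succ a ih => simp only [pow_succ', Module.End.mul_apply, ih, opL_leftMul]
    rw [h, hz, map_smul, ladderLeft_leftMul]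

/-! ### Divided powers and the two formulas -/

theorem qFactorial_ne_zero_of_le {m n : ℕ} (h : m ≤ n) (hn : qFactorial p n ≠ 0) :
    qFactorial p m ≠ 0 := by
  rw [qFactorial, Finset.prod_ne_zero_iff] at hn ⊢
  exact fun i hi => hn i (Finset.range_mono h hi)

theorem qDividedPower_opR {a : ℕ} (h : qFactorial p a ≠ 0) :
    qDividedPower p (opR b p) a = ladderRight b p a :=
  LinearMap.ext fun z => by
    rw [qDividedPower, LinearMap.smul_apply, opR_pow_apply, inv_smul_smul₀ h]

theorem qDividedPower_opL {a : ℕ} (h : qFactorial p a ≠ 0) :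
    qDividedPower p (opL b p) a = ladderLeft b p a :=
  LinearMap.ext fun z => by
    rw [qDividedPower, LinearMap.smul_apply, opL_pow_apply, inv_smul_smul₀ h]

theorem word_mem (E : Finset ι) : word b E ∈ ⋀[F]^E.card V := by
  -- Expressing the cardinality as a list length lets the sorted list be replaced by an arbitrary
  -- one for the induction.
  rw [word, ← Finset.length_sort (· ≤ ·) (s := E)]
  induction E.sort (· ≤ ·) with
  | nil => simp
  | cons i l ih => simpa using ι_mul_mem (b i) ih

end

end DeformedExterior

open DeformedExterior in
theorem mainTheorem5 {F V ι : Type*} [Field F] [AddCommGroup V] [Module F V] [LinearOrder ι]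
    (b : Module.Basis ι F V) (p : F) (hp : p ≠ 0) :
    (∀ E G : Finset ι, DeformedExterior.qFactorial p (max E.card G.card) ≠ 0 →
      DeformedExterior.braiding b p
          (DeformedExterior.word b E ⊗ₜ[F] DeformedExterior.word b G) =
        ∑ k ∈ Finset.range (min E.card G.card + 1), DeformedExterior.signedGauss p k •
          DeformedExterior.qDividedPower p (DeformedExterior.opL b p) (G.card - k)
            (DeformedExterior.qDividedPower p (DeformedExterior.opR b p) (E.card - k)
              (DeformedExterior.word b E ⊗ₜ[F] DeformedExterior.word b G))) ∧
    (∀ m n : ℕ,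
      DeformedExterior.braiding b p ∘ₗ
          TensorProduct.map (DeformedExterior.degProj m) (DeformedExterior.degProj n) =
        ∑ k ∈ Finset.range (min m n + 1), DeformedExterior.signedGauss p k •
          (DeformedExterior.ladderLeft b p (n - k) ∘ₗ DeformedExterior.ladderRight b p (m - k) ∘ₗ
            TensorProduct.map (DeformedExterior.degProj m) (DeformedExterior.degProj n))) := by
  refine ⟨fun E G h => ?_, fun m n => TensorProduct.ext' fun x y => ?_⟩
  · rw [braiding_of_mem b p (word_mem b E) (word_mem b G)]
    refine Finset.sum_congr rfl fun k _ => ?_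
    rw [qDividedPower_opL b p (qFactorial_ne_zero_of_le p (by omega) h),
      qDividedPower_opR b p (qFactorial_ne_zero_of_le p (by omega) h)]
  · rw [LinearMap.comp_apply, TensorProduct.map_tmul,
      braiding_of_mem b p (degProj_mem m x) (degProj_mem n y)]
    simp [LinearMap.sum_apply]
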